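/- **Irregular channel polarization.** A binary-input discrete memoryless channel (B-DMC) $W$ with finite output alphabet $\mathcal Y$ is given by transition probabilities $W(y\mid x)$, $x\in\{0,1\}$, $y\in\mathcal Y$; its symmetric capacity is the mutual information (in bits) between a uniform input and the output, $$I(W)=\sum_{y\in\mathcal Y}\sum_{x\in\{0,1\}}\tfrac12 W(y\mid x)\log_2\frac{W(y\mid x)}{\tfrac12W(y\mid 0)+\tfrac12W(y\mid 1)}\in[0,1].$$ Let $N=2^n$ and $\mathbf G_N=\mathbf R\,\mathbf F^{\otimes n}$ over $\mathbb F_2$, where $\mathbf F=\begin{bmatrix}1&0\\1&1\end{bmatrix}$ and $\mathbf R$ is the $N\times N$ bit-reversal permutation matrix. Given B-DMCs $W^1,\dots,W^N$ with $W^i:\{0,1\}\to\mathcal Y_i$, used independently, put $W_N(y^{1:N}\mid u^{1:N})=\prod_{i=1}^N W^i\big(y^i\mid (u^{1:N}\mathbf G_N)_i\big)$, and define the synthesized channels, for $1\le i\le N$, by $$W_N^{(i)}(y^{1:N},u^{1:i-1}\mid u^i)=\sum_{u^{i+1:N}\in\{0,1\}^{N-i}}\frac1{2^{N-1}}W_N(y^{1:N}\mid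 u^{1:N}).$$ Let $\mathbb A[I(W^{1:N})]=\frac1N\sum_{i=1}^N I(W^i)$. For every $n\ge 0$ let $W^{1:N}=W^{1:N}_{[n]}$ be an arbitrary family of $N=2^n$ B-DMCs with finite output alphabets; the channels may have different transition probabilities and different output alphabets, and the families for different $n$ need not be related. Then for every fixed $\delta\in(0,1)$, as $N=2^n\to\infty$, $$\frac{\#\{i: I(W_N^{(i)})\in(1-\delta,1]\}}{N}-\mathbb A[I(W^{1:N})]\to0,\qquad \frac{\#\{i: I(W_N^{(i)})\in[0,\delta)\}}{N}-\big(1-\mathbb A[I(W^{1:N})]\big)\to0.$$ In other words, the law of $I(W_N^{(i)})$ for uniformly random $i$ is asymptotically that of a random variable equal to $1$ with probability $\mathbb A[I(W^{1:N})]$ and to $0$ otherwise: for every continuous $g:[0,1]\to\mathbb R$, $$\frac1N\sum_{i=1}^N g\big(I(W_N^{(i)})\big)-\Big(\mathbb A[I(W^{1:N})]\,g(1)+\big(1-\mathbb A[I(W^{1:N})]\big)g(0)\Big)\to0 .$$ -/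

import Mathlib

open scoped Matrix

namespace IrregularPolar

/-- A binary-input discrete memoryless channel with finite output alphabet `Y`:
`W.prob x y` is the transition probability `W(y | x)`. The input alphabet `{0, 1}` with addition
mod 2 is `ZMod 2`. -/
structure BDMC (Y : Type*) [Fintype Y] where
  prob : ZMod 2 → Y → ℝ
  nonneg : ∀ x y, 0 ≤ prob x y
  sum_eq_one : ∀ x, ∑ y, prob x y = 1

/-- The symmetric capacity `I(W)` in bits: the mutual information between a uniformly distributed
input and the output. -/
noncomputable def BDMC.symmCapacity {Y : Type*} [Fintype Y] (W : BDMC Y) : ℝ :=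
  ∑ y, ∑ x, (1 / 2 : ℝ) * W.prob x y *
    Real.logb 2 (W.prob x y / (∑ x', (1 / 2 : ℝ) * W.prob x' y))

/-- The kernel `F`. -/
def kernelF : Matrix (Fin 2) (Fin 2) (ZMod 2) := !![1, 0; 1, 1]

/-- Binary digits of an index; `bits i k` is the coefficient of `2 ^ k`. -/
def bits {n : ℕ} : Fin (2 ^ n) ≃ (Fin n → Fin 2) := finFunctionFinEquiv.symm

/-- The Kronecker power `F^{⊗ n}`, entrywise: the `(i, j)` entry is the product over all digit
positions of the entries of `F` at the digits of `i` and `j`. -/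
def kroneckerPowF (n : ℕ) : Matrix (Fin (2 ^ n)) (Fin (2 ^ n)) (ZMod 2) :=
  Matrix.of fun i j => ∏ k : Fin n, kernelF (bits i k) (bits j k)

/-- The permutation of the indices that reverses the order of the `n` binary digits. -/
def bitReversal (n : ℕ) : Equiv.Perm (Fin (2 ^ n)) :=
  bits.trans ((Equiv.arrowCongr Fin.revPerm (Equiv.refl (Fin 2))).trans bits.symm)

/-- The polar transform `G_N = R F^{⊗ n}`, `N = 2 ^ n`, with `R` the bit-reversal matrix. -/
def polarMatrix (n : ℕ) : Matrix (Fin (2 ^ n)) (Fin (2 ^ n)) (ZMod 2) :=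
  (bitReversal n).permMatrix (ZMod 2) * kroneckerPowF n

section Transform

variable {n : ℕ} {Y : Fin (2 ^ n) → Type*} [∀ i, Fintype (Y i)]

/-- Channel combining: `W_N(y | u) = ∏ i, W^i(y_i | (u G_N)_i)`. -/
def combined (W : (i : Fin (2 ^ n)) → BDMC (Y i)) (u : Fin (2 ^ n) → ZMod 2)
    (y : (i : Fin (2 ^ n)) → Y i) : ℝ :=
  ∏ i, (W i).prob ((u ᵥ* polarMatrix n) i) (y i)

/-- Transition probability of the `i`-th split channel,
`W_N^{(i)}(y, u_{<i} | u_i) = ∑_{u_{>i}} 2^{-(N-1)} W_N(y | u)`. -/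
noncomputable def splitProb (W : (i : Fin (2 ^ n)) → BDMC (Y i)) (i : Fin (2 ^ n)) (x : ZMod 2)
    (o : ((j : Fin (2 ^ n)) → Y j) × ({j : Fin (2 ^ n) // j < i} → ZMod 2)) : ℝ :=
  ∑ u : Fin (2 ^ n) → ZMod 2 with u i = x ∧ (fun j : {j // j < i} => u j) = o.2,
    1 / 2 ^ (2 ^ n - 1) * combined W u o.1

theorem combined_nonneg (W : (i : Fin (2 ^ n)) → BDMC (Y i)) (u : Fin (2 ^ n) → ZMod 2)
    (y : (i : Fin (2 ^ n)) → Y i) : 0 ≤ combined W u y :=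
  Finset.prod_nonneg fun i _ => (W i).nonneg _ _

theorem sum_combined (W : (i : Fin (2 ^ n)) → BDMC (Y i)) (u : Fin (2 ^ n) → ZMod 2) :
    ∑ y, combined W u y = 1 := by
  classical
  unfold combined
  rw [← Fintype.prod_sum (fun i y => (W i).prob ((u ᵥ* polarMatrix n) i) y)]
  simp [BDMC.sum_eq_one]

theorem card_fix (i : Fin (2 ^ n)) (x : ZMod 2) :
    (Finset.univ.filter fun u : Fin (2 ^ n) → ZMod 2 => u i = x).card = 2 ^ (2 ^ n - 1) := by
  have h : (Finset.univ.filter fun u : Fin (2 ^ n) → ZMod 2 => u i = x)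
      = Fintype.piFinset (fun j => if j = i then {x} else Finset.univ) := by
    ext u
    simp only [Finset.mem_filter, Finset.mem_univ, true_and, Fintype.mem_piFinset]
    constructor
    · intro hu j
      split_ifs with hj
      · subst hj; simpa using hu
      · simp
    · intro hu
      simpa using hu i
  rw [h, Fintype.card_piFinset]
  have h2 : ∀ j, (if j = i then ({x} : Finset (ZMod 2)) else Finset.univ).card
      = if j = i then 1 else 2 := by
    intro j
    split_ifs <;> simp [ZMod.card]
  simp only [h2]
  rw [Finset.prod_ite]
  simp [Finset.filter_ne']

theorem sum_splitProb (W : (i : Fin (2 ^ n)) → BDMC (Y i)) (i : Fin (2 ^ n)) (x : ZMod 2) :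
    ∑ o, splitProb W i x o = 1 := by
  classical
  rw [Fintype.sum_prod_type]
  have h : ∀ y : (j : Fin (2 ^ n)) → Y j, ∑ v, splitProb W i x (y, v)
      = ∑ u : Fin (2 ^ n) → ZMod 2 with u i = x,
          1 / 2 ^ (2 ^ n - 1) * combined W u y := by
    intro y
    simp only [splitProb, ← Finset.filter_filter]
    exact Finset.sum_fiberwise _ _ _
  simp only [h]
  rw [Finset.sum_comm]
  simp only [← Finset.mul_sum, sum_combined]
  rw [Finset.sum_const, card_fix]
  simp

/-- Channel splitting: the synthesized channel `W_N^{(i)}`, with input `u_i` and output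
`(y, u_{<i})`. -/
noncomputable def synthesized (W : (i : Fin (2 ^ n)) → BDMC (Y i)) (i : Fin (2 ^ n)) :
    BDMC (((j : Fin (2 ^ n)) → Y j) × ({j : Fin (2 ^ n) // j < i} → ZMod 2)) where
  prob := splitProb W i
  nonneg x o := Finset.sum_nonneg fun u _ =>
    mul_nonneg (by positivity) (combined_nonneg W u o.1)
  sum_eq_one := sum_splitProb W i

/-- The average `A[I(W^{1:N})]` of the symmetric capacities of the initial channels. -/
noncomputable def averageCapacity (W : (i : Fin (2 ^ n)) → BDMC (Y i)) : ℝ :=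
  (∑ i, (W i).symmCapacity) / 2 ^ n

/-- The fraction of indices `i` for which `I(W_N^{(i)})` lies in `S`. -/
noncomputable def fractionIn (W : (i : Fin (2 ^ n)) → BDMC (Y i)) (S : Set ℝ) : ℝ :=
  ({i : Fin (2 ^ n) | (synthesized W i).symmCapacity ∈ S}.ncard : ℝ) / 2 ^ n

end Transform

end IrregularPolar

/-! Total capacity is conserved by every pairwise combination (chain rule,
`minusInfo_add_plusInfo`), so the average initial capacity is the average of the synthesized
capacities. Each claim then says that a function which is small near 0 and 1, hence at most ε plus a
multiple of `spread` x(1-x), has vanishing average. It is enough that the average `spread` tends to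
0, uniformly over all families of channels.

Concavity of the binary entropy, together with its bound by 2√(p(1-p)), gives a' ≤ a(1 - c(1-b)²)
for the worse of the two combined channels (`minusInfo_le_left`). A combination never increases
total `spread`, but it may preserve it: capacities 1/2 and 1 are left as they are. Since the two
channels combined may differ, the usual martingale argument for equal channels is unavailable.

Instead, L consecutive levels are treated together. A step from (a, b) to (a', b') loses `spread` at
least 2(min a b - a')² (`PairStep.sq_le`). If a whole window loses very little, each step nearly
sorts its two inputs, and no step has two middling inputs (`PairStep.gap_le`). The window is then
close to a network of comparators, whose outputs are monotone on the Boolean cube and whose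
nonpolarized positions form an antichain (`Window.exists_comparator`). Sperner's theorem allows at
most `L.choose (L / 2)` of them, a vanishing fraction of 2^L. So a window either ends nearly
polarized or loses a definite amount of `spread` (`exists_window_bound`), and iterating this
dichotomy contracts the average to an arbitrarily small level (`exists_spreadBound`). -/

namespace IrregularPolar

/-! ### Information carried by one output letter -/

open Real in
/-- The contribution of one output letter with likelihoods `a` and `b` to the symmetric capacity. -/
noncomputable def letterInfo (a b : ℝ) : ℝ :=
  (negMulLog ((a + b) / 2) - (negMulLog a + negMulLog b) / 2) / log 2

open Real in
theorem letterInfo_eq_logb {a b : ℝ} (ha : 0 ≤ a) (hb : 0 ≤ b) :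
    1 / 2 * a * logb 2 (a / (1 / 2 * a + 1 / 2 * b)) +
      1 / 2 * b * logb 2 (b / (1 / 2 * a + 1 / 2 * b)) = letterInfo a b := by
  have key : ∀ {x m : ℝ}, 0 ≤ x → (x ≠ 0 → m ≠ 0) →
      x * logb 2 (x / m) = (-negMulLog x - x * log m) / log 2 := by
    intro x m _ hm
    rcases eq_or_ne x 0 with rfl | hx
    · simp
    · rw [logb, log_div hx (hm hx), negMulLog]; ring
  have h1 : a ≠ 0 → 1 / 2 * a + 1 / 2 * b ≠ 0 := fun h => by
    have := lt_of_le_of_ne ha h.symm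
    positivity
  have h2 : b ≠ 0 → 1 / 2 * a + 1 / 2 * b ≠ 0 := fun h => by
    have := lt_of_le_of_ne hb h.symm
    positivity
  rw [mul_assoc, mul_assoc (1 / 2) b, key ha h1, key hb h2, letterInfo,
    show (a + b) / 2 = 1 / 2 * a + 1 / 2 * b by ring]
  simp only [negMulLog]
  ring

theorem sum_zmod_two {M : Type*} [AddCommMonoid M] (f : ZMod 2 → M) : ∑ x, f x = f 0 + f 1 :=
  Fin.sum_univ_two f

theorem symmCapacity_eq_sum_letterInfo {Y : Type*} [Fintype Y] (W : BDMC Y) :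
    W.symmCapacity = ∑ y, letterInfo (W.prob 0 y) (W.prob 1 y) := by
  unfold BDMC.symmCapacity
  refine Finset.sum_congr rfl fun y _ => ?_
  simp only [sum_zmod_two]
  exact letterInfo_eq_logb (W.nonneg _ _) (W.nonneg _ _)

theorem letterInfo_comm (a b : ℝ) : letterInfo a b = letterInfo b a := by
  simp only [letterInfo, add_comm]

-- Here m is the probability of the letter under a uniform input and p is the posterior probability
-- of input 0. In these coordinates, inequalities about letters become inequalities about
-- `binEntropy`.
open Real in
theorem letterInfo_param (m p : ℝ) :
    letterInfo (2 * m * p) (2 * m * (1 - p)) = m * (1 - binEntropy p / log 2) := by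
  have h2 : log 2 ≠ 0 := (log_pos one_lt_two).ne'
  rw [letterInfo, show (2 * m * p + 2 * m * (1 - p)) / 2 = m by ring,
    negMulLog_mul (2 * m), negMulLog_mul (2 * m), negMulLog_mul 2 m,
    binEntropy_eq_negMulLog_add_negMulLog_one_sub]
  have : negMulLog 2 = -2 * log 2 := by simp [negMulLog]
  rw [this]
  field_simp
  ring

theorem exists_param {a b : ℝ} (ha : 0 ≤ a) (hb : 0 ≤ b) :
    ∃ m p : ℝ, 0 ≤ m ∧ 0 ≤ p ∧ p ≤ 1 ∧ a = 2 * m * p ∧ b = 2 * m * (1 - p) := by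
  rcases (add_nonneg ha hb).eq_or_lt with h | h
  · exact ⟨0, 0, le_rfl, le_rfl, zero_le_one, by linarith, by linarith⟩
  · refine ⟨(a + b) / 2, a / (a + b), by positivity, by positivity,
      div_le_one_of_le₀ (by linarith) h.le, by field_simp, by field_simp; ring⟩

open Real in
theorem letterInfo_nonneg {a b : ℝ} (ha : 0 ≤ a) (hb : 0 ≤ b) : 0 ≤ letterInfo a b := by
  obtain ⟨m, p, hm, hp0, hp1, rfl, rfl⟩ := exists_param ha hb
  rw [letterInfo_param]
  refine mul_nonneg hm (sub_nonneg.2 (div_le_one_of_le₀ binEntropy_le_log_two ?_))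
  exact (log_pos one_lt_two).le

open Real in
theorem letterInfo_le {a b : ℝ} (ha : 0 ≤ a) (hb : 0 ≤ b) : letterInfo a b ≤ (a + b) / 2 := by
  obtain ⟨m, p, hm, hp0, hp1, rfl, rfl⟩ := exists_param ha hb
  rw [letterInfo_param]
  have : 0 ≤ binEntropy p / log 2 :=
    div_nonneg (binEntropy_nonneg hp0 hp1) (log_pos one_lt_two).le
  nlinarith [mul_nonneg hm this]

open Real in
/-- Mixing the likelihoods with a useless letter does not increase the information. -/
theorem letterInfo_mix_le {a b s r : ℝ} (ha : 0 ≤ a) (hb : 0 ≤ b) (hs : 0 ≤ s) (hr : 0 ≤ r) :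
    letterInfo (s * a + r) (s * b + r) ≤ s * letterInfo a b := by
  obtain ⟨m, p, hm, hp0, hp1, rfl, rfl⟩ := exists_param ha hb
  have hlog : 0 < log 2 := log_pos one_lt_two
  have hsm := mul_nonneg hs hm
  rcases (add_nonneg hsm hr).eq_or_lt with h | h
  · have h1 : s * m = 0 := by linarith
    have h2 : r = 0 := by linarith
    have h3 : s * (2 * m * p) + r = 0 := by linear_combination 2 * p * h1 + h2
    have h4 : s * (2 * m * (1 - p)) + r = 0 := by linear_combination 2 * (1 - p) * h1 + h2
    rw [h3, h4, letterInfo_param, ← mul_assoc, h1]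
    simp [letterInfo]
  · set M := s * m + r with hM
    set t := s * m / M with ht
    have ht0 : 0 ≤ t := by positivity
    have hMt : M * t = s * m := by rw [ht]; field_simp
    have ht1 : t ≤ 1 := div_le_one_of_le₀ (by linarith) h.le
    have hr' : r = M * (1 - t) := by linear_combination hM + hMt
    -- The mixed letter has mass M, and its posterior is the average of p (weight t) and 1/2 (weight
    -- 1 - t), where the entropy is maximal.
    have hconc := strictConcave_binEntropy.concaveOn.2 (show p ∈ Set.Icc (0 : ℝ) 1 from ⟨hp0, hp1⟩)
      (show (2⁻¹ : ℝ) ∈ Set.Icc (0 : ℝ) 1 by norm_num) ht0 (sub_nonneg.2 ht1) (by ring)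
    simp only [smul_eq_mul, binEntropy_two_inv] at hconc
    have e1 : s * (2 * m * p) + r = 2 * M * (t * p + (1 - t) * 2⁻¹) := by
      rw [hr']; linear_combination -2 * p * hMt
    have e2 : s * (2 * m * (1 - p)) + r = 2 * M * (1 - (t * p + (1 - t) * 2⁻¹)) := by
      rw [hr']; linear_combination -2 * (1 - p) * hMt
    rw [e1, e2, letterInfo_param, letterInfo_param, ← mul_assoc, ← hMt, mul_assoc]
    refine mul_le_mul_of_nonneg_left ?_ h.le
    have h5 := div_le_div_of_nonneg_right hconc hlog.le
    have h6 : (t * binEntropy p + (1 - t) * log 2) / log 2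
        = t * (binEntropy p / log 2) + (1 - t) := by field_simp
    rw [h6] at h5
    linarith

-- This is log t ≤ t - 1 at t = 1/√x, multiplied by 2x.
open Real in
theorem negMulLog_le_sqrt {x : ℝ} (hx : 0 ≤ x) : negMulLog x ≤ 2 * (√x - x) := by
  rcases hx.eq_or_lt with rfl | hx
  · simp
  · have hs : 0 < √x := sqrt_pos.2 hx
    have h := log_le_sub_one_of_pos (inv_pos.2 hs)
    rw [log_inv, log_sqrt hx.le] at h
    have h2 : x * (√x)⁻¹ = √x := by
      rw [← div_eq_mul_inv, div_sqrt]
    rw [negMulLog]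
    nlinarith

-- With u = √p and w = √(1-p), the previous bound gives entropy at most 2(u + w - 1), and u + w ≤ 1
-- + uw.
open Real in
theorem binEntropy_sq_le {p : ℝ} (h0 : 0 ≤ p) (h1 : p ≤ 1) :
    binEntropy p ^ 2 ≤ 4 * (p * (1 - p)) := by
  have h1' : 0 ≤ 1 - p := sub_nonneg.2 h1
  have ha := negMulLog_le_sqrt h0
  have hb := negMulLog_le_sqrt h1'
  have sa := sq_sqrt h0
  have sb := sq_sqrt h1'
  have na := sqrt_nonneg p
  have nb := sqrt_nonneg (1 - p)
  set u := √p
  set w := √(1 - p)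
  have huw : u + w ≤ 1 + u * w := by
    have : (u + w) ^ 2 ≤ (1 + u * w) ^ 2 := by nlinarith [mul_nonneg na nb]
    exact le_of_sq_le_sq this (by positivity)
  have hle : binEntropy p ≤ 2 * (u * w) := by
    rw [binEntropy_eq_negMulLog_add_negMulLog_one_sub]
    linarith
  have := pow_le_pow_left₀ (binEntropy_nonneg h0 h1) hle 2
  calc _ ≤ _ := this
    _ = 4 * (p * (1 - p)) := by linear_combination 4 * w ^ 2 * sa + 4 * p * sb

/-- The constant in the quantitative polarization step. -/
noncomputable def gapConst : ℝ := Real.log 2 ^ 2 / 2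

theorem gapConst_pos : 0 < gapConst := by
  have := Real.log_pos one_lt_two
  unfold gapConst
  positivity

-- In normalized form, |2p-1| ≤ 1 - 2p(1-p) ≤ 1 - c h², with h the entropy in bits. The square is
-- replaced by its tangent line 2Hh - H² at a free point H, so that the bound is linear in the
-- letter information and can be summed over letters.
open Real in
theorem abs_sub_half_le {a b : ℝ} (ha : 0 ≤ a) (hb : 0 ≤ b) (H : ℝ) :
    |a - b| / 2 ≤ (a + b) / 2 -
      gapConst * (2 * H * ((a + b) / 2 - letterInfo a b) - H ^ 2 * ((a + b) / 2)) := by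
  obtain ⟨m, p, hm, hp0, hp1, rfl, rfl⟩ := exists_param ha hb
  have hlog : 0 < log 2 := log_pos one_lt_two
  rw [letterInfo_param, show 2 * m * p - 2 * m * (1 - p) = 2 * m * (2 * p - 1) by ring, abs_mul,
    abs_of_nonneg (by positivity : 0 ≤ 2 * m),
    show (2 * m * p + 2 * m * (1 - p)) / 2 = m by ring]
  set h := binEntropy p / log 2 with hh
  have hsq : gapConst * h ^ 2 ≤ 2 * (p * (1 - p)) := by
    have := binEntropy_sq_le hp0 hp1
    rw [gapConst, hh, div_pow]
    field_simp
    linarith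
  have habs : |2 * p - 1| ≤ 1 - 2 * (p * (1 - p)) := abs_le.2 ⟨by nlinarith, by nlinarith⟩
  have hc := gapConst_pos
  have hlin : gapConst * (2 * H * h - H ^ 2) ≤ gapConst * h ^ 2 :=
    mul_le_mul_of_nonneg_left (by nlinarith [sq_nonneg (h - H)]) hc.le
  have : m * |2 * p - 1| ≤ m * (1 - gapConst * (2 * H * h - H ^ 2)) :=
    mul_le_mul_of_nonneg_left (by linarith) hm
  calc _ = m * |2 * p - 1| := by ring
    _ ≤ _ := this
    _ = _ := by ring

/-! ### Capacities of the two combinations of a pair of channels -/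

section Pair

variable {Y Z : Type*} [Fintype Y] [Fintype Z]

theorem sum_half_eq_one (W : BDMC Y) : ∑ y, (W.prob 0 y + W.prob 1 y) / 2 = 1 := by
  rw [← Finset.sum_div, Finset.sum_add_distrib, W.sum_eq_one, W.sum_eq_one]
  norm_num

theorem symmCapacity_nonneg (W : BDMC Y) : 0 ≤ W.symmCapacity := by
  rw [symmCapacity_eq_sum_letterInfo]
  exact Finset.sum_nonneg fun y _ => letterInfo_nonneg (W.nonneg _ _) (W.nonneg _ _)

theorem symmCapacity_le_one (W : BDMC Y) : W.symmCapacity ≤ 1 := by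
  rw [symmCapacity_eq_sum_letterInfo, ← sum_half_eq_one W]
  exact Finset.sum_le_sum fun y _ => letterInfo_le (W.nonneg _ _) (W.nonneg _ _)

/-- Jensen's inequality: the tangent point H is the mean conditional entropy of the input given the
output. -/
theorem sum_abs_sub_half_le (W : BDMC Y) :
    ∑ y, |W.prob 0 y - W.prob 1 y| / 2 ≤ 1 - gapConst * (1 - W.symmCapacity) ^ 2 := by
  set H := 1 - W.symmCapacity with hH
  calc _ ≤ ∑ y, ((W.prob 0 y + W.prob 1 y) / 2 - gapConst * (2 * H * ((W.prob 0 y + W.prob 1 y) / 2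
          - letterInfo (W.prob 0 y) (W.prob 1 y)) - H ^ 2 * ((W.prob 0 y + W.prob 1 y) / 2))) :=
        Finset.sum_le_sum fun y _ => abs_sub_half_le (W.nonneg _ _) (W.nonneg _ _) H
    _ = 1 - gapConst * (2 * H * (1 - W.symmCapacity) - H ^ 2 * 1) := by
        rw [Finset.sum_sub_distrib, ← Finset.mul_sum, Finset.sum_sub_distrib, ← Finset.mul_sum,
          ← Finset.mul_sum, Finset.sum_sub_distrib, sum_half_eq_one,
          ← symmCapacity_eq_sum_letterInfo]
    _ = _ := by rw [← hH]; ring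

/-- The capacity of the check-node combination of two channels. -/
noncomputable def minusInfo (A : BDMC Y) (B : BDMC Z) : ℝ :=
  ∑ y, ∑ z, letterInfo (1 / 2 * (A.prob 0 y * B.prob 0 z + A.prob 1 y * B.prob 1 z))
    (1 / 2 * (A.prob 1 y * B.prob 0 z + A.prob 0 y * B.prob 1 z))

/-- The capacity of the variable-node combination of two channels. -/
noncomputable def plusInfo (A : BDMC Y) (B : BDMC Z) : ℝ :=
  ∑ y, ∑ z, (letterInfo (1 / 2 * (A.prob 0 y * B.prob 0 z)) (1 / 2 * (A.prob 1 y * B.prob 1 z))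
    + letterInfo (1 / 2 * (A.prob 1 y * B.prob 0 z)) (1 / 2 * (A.prob 0 y * B.prob 1 z)))

/-- For d ≤ c the combined letter is (a, b) scaled by (c-d)/2 plus the useless mass d(a+b)/2 on both
sides, so `letterInfo_mix_le` applies. Exchanging c and d only swaps the two likelihoods. -/
theorem letterInfo_check_le {a b c d : ℝ} (ha : 0 ≤ a) (hb : 0 ≤ b) (hc : 0 ≤ c) (hd : 0 ≤ d) :
    letterInfo (1 / 2 * (a * c + b * d)) (1 / 2 * (b * c + a * d)) ≤
      letterInfo a b * (|c - d| / 2) := by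
  wlog h : d ≤ c generalizing c d with H
  · have := H hd hc (le_of_not_ge h)
    rw [letterInfo_comm, abs_sub_comm c d]
    convert this using 2 <;> ring
  · rw [abs_of_nonneg (sub_nonneg.2 h), mul_comm (letterInfo a b)]
    convert letterInfo_mix_le ha hb (s := (c - d) / 2) (r := d * (a + b) / 2)
      (by linarith) (by positivity) using 2 <;> ring

theorem minusInfo_le_left (A : BDMC Y) (B : BDMC Z) :
    minusInfo A B ≤ A.symmCapacity * (1 - gapConst * (1 - B.symmCapacity) ^ 2) := by
  calc minusInfo A B ≤ ∑ y, ∑ z, letterInfo (A.prob 0 y) (A.prob 1 y) *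
        (|B.prob 0 z - B.prob 1 z| / 2) :=
        Finset.sum_le_sum fun y _ => Finset.sum_le_sum fun z _ =>
          letterInfo_check_le (A.nonneg _ _) (A.nonneg _ _) (B.nonneg _ _) (B.nonneg _ _)
    _ = A.symmCapacity * ∑ z, |B.prob 0 z - B.prob 1 z| / 2 := by
        rw [symmCapacity_eq_sum_letterInfo, Finset.sum_mul_sum]
    _ ≤ _ := mul_le_mul_of_nonneg_left (sum_abs_sub_half_le B) (symmCapacity_nonneg A)

theorem minusInfo_comm (A : BDMC Y) (B : BDMC Z) : minusInfo A B = minusInfo B A := by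
  unfold minusInfo
  rw [Finset.sum_comm]
  refine Finset.sum_congr rfl fun z _ => Finset.sum_congr rfl fun y _ => ?_
  congr 1 <;> ring

/-- The chain rule for mutual information, valid already for each pair of output letters. -/
theorem letterInfo_chain (a b c d : ℝ) :
    letterInfo (1 / 2 * (a * c + b * d)) (1 / 2 * (b * c + a * d)) +
      (letterInfo (1 / 2 * (a * c)) (1 / 2 * (b * d))
        + letterInfo (1 / 2 * (b * c)) (1 / 2 * (a * d))) =
    letterInfo a b * ((c + d) / 2) + (a + b) / 2 * letterInfo c d := by
  simp only [letterInfo]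
  rw [show (1 / 2 * (a * c + b * d) + 1 / 2 * (b * c + a * d)) / 2 = (a + b) / 2 * ((c + d) / 2)
      by ring,
    show (1 / 2 * (a * c) + 1 / 2 * (b * d)) / 2 = 1 / 2 * (1 / 2 * (a * c + b * d)) by ring,
    show (1 / 2 * (b * c) + 1 / 2 * (a * d)) / 2 = 1 / 2 * (1 / 2 * (b * c + a * d)) by ring]
  simp only [Real.negMulLog_mul (1 / 2) (1 / 2 * _), Real.negMulLog_mul (1 / 2) (_ * _),
    Real.negMulLog_mul a, Real.negMulLog_mul b, Real.negMulLog_mul ((a + b) / 2)]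
  ring

theorem minusInfo_add_plusInfo (A : BDMC Y) (B : BDMC Z) :
    minusInfo A B + plusInfo A B = A.symmCapacity + B.symmCapacity := by
  unfold minusInfo plusInfo
  simp only [← Finset.sum_add_distrib, letterInfo_chain]
  simp only [Finset.sum_add_distrib, ← Finset.sum_mul_sum, sum_half_eq_one,
    ← symmCapacity_eq_sum_letterInfo]
  ring

end Pair

/-! ### Binary digits and the recursion of the polar matrix -/

section Index

variable {n : ℕ}

/-- The index `2 i`. -/
def evenIdx (i : Fin (2 ^ n)) : Fin (2 ^ (n + 1)) := ⟨2 * i, by have := i.2; omega⟩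

/-- The index `2 i + 1`. -/
def oddIdx (i : Fin (2 ^ n)) : Fin (2 ^ (n + 1)) := ⟨2 * i + 1, by have := i.2; omega⟩

/-- The index `i` in the lower half. -/
def lowIdx (i : Fin (2 ^ n)) : Fin (2 ^ (n + 1)) := ⟨i, by have := i.2; omega⟩

/-- The index `i` in the upper half. -/
def highIdx (i : Fin (2 ^ n)) : Fin (2 ^ (n + 1)) := ⟨2 ^ n + i, by have := i.2; omega⟩

/-- Even and odd indices. -/
noncomputable def parityEquiv (n : ℕ) : Fin (2 ^ n) ⊕ Fin (2 ^ n) ≃ Fin (2 ^ (n + 1)) :=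
  Equiv.ofBijective (Sum.elim evenIdx oddIdx) <| by
    constructor
    · rintro (i | i) (j | j) h <;> simp [evenIdx, oddIdx, Fin.ext_iff] at h ⊢ <;> omega
    · intro k
      have := k.2
      rcases Nat.even_or_odd' (k : ℕ) with ⟨c, hc | hc⟩
      · exact ⟨Sum.inl ⟨c, by omega⟩, by simp [evenIdx, Fin.ext_iff, hc]⟩
      · exact ⟨Sum.inr ⟨c, by omega⟩, by simp [oddIdx, Fin.ext_iff, hc]⟩

/-- Lower and upper half of the indices. -/
noncomputable def halfEquiv (n : ℕ) : Fin (2 ^ n) ⊕ Fin (2 ^ n) ≃ Fin (2 ^ (n + 1)) :=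
  Equiv.ofBijective (Sum.elim lowIdx highIdx) <| by
    constructor
    · rintro (i | i) (j | j) h <;> have := i.2 <;> have := j.2 <;>
        simp [lowIdx, highIdx, Fin.ext_iff] at h ⊢ <;> omega
    · intro k
      have := k.2
      by_cases hk : (k : ℕ) < 2 ^ n
      · exact ⟨Sum.inl ⟨k, hk⟩, by simp [lowIdx]⟩
      · exact ⟨Sum.inr ⟨k - 2 ^ n, by omega⟩, by simp [highIdx, Fin.ext_iff]; omega⟩

theorem exists_parity (k : Fin (2 ^ (n + 1))) : ∃ i, k = evenIdx i ∨ k = oddIdx i := by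
  obtain ⟨i | i, rfl⟩ := (parityEquiv n).surjective k
  · exact ⟨i, Or.inl rfl⟩
  · exact ⟨i, Or.inr rfl⟩

theorem exists_half (k : Fin (2 ^ (n + 1))) : ∃ i, k = lowIdx i ∨ k = highIdx i := by
  obtain ⟨i | i, rfl⟩ := (halfEquiv n).surjective k
  · exact ⟨i, Or.inl rfl⟩
  · exact ⟨i, Or.inr rfl⟩

theorem sum_parity {M : Type*} [AddCommMonoid M] (f : Fin (2 ^ (n + 1)) → M) :
    ∑ k, f k = ∑ i, (f (evenIdx i) + f (oddIdx i)) := by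
  rw [← (parityEquiv n).sum_comp f, Fintype.sum_sum_type, Finset.sum_add_distrib]
  rfl

theorem sum_half {M : Type*} [AddCommMonoid M] (f : Fin (2 ^ (n + 1)) → M) :
    ∑ k, f k = ∑ i, f (lowIdx i) + ∑ i, f (highIdx i) := by
  rw [← (halfEquiv n).sum_comp f, Fintype.sum_sum_type]
  rfl

theorem prod_half {M : Type*} [CommMonoid M] (f : Fin (2 ^ (n + 1)) → M) :
    ∏ k, f k = (∏ i, f (lowIdx i)) * ∏ i, f (highIdx i) := by
  rw [← (halfEquiv n).prod_comp f, Fintype.prod_sum_type]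
  rfl

theorem bits_val (i : Fin (2 ^ n)) (k : Fin n) : (bits i k : ℕ) = i / 2 ^ (k : ℕ) % 2 := by
  simp [bits, finFunctionFinEquiv]

theorem polarMatrix_apply (i j : Fin (2 ^ n)) :
    polarMatrix n i j = ∏ k, kernelF (bits i k.rev) (bits j k) := by
  simp only [polarMatrix, Equiv.Perm.permMatrix, PEquiv.toMatrix_toPEquiv_mul, kroneckerPowF]
  simp [bitReversal, Equiv.arrowCongr]

theorem bits_evenIdx_zero (i : Fin (2 ^ n)) : bits (evenIdx i) 0 = 0 := by
  ext; simp [bits_val, evenIdx]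

theorem bits_oddIdx_zero (i : Fin (2 ^ n)) : bits (oddIdx i) 0 = 1 := by
  ext; simp [bits_val, oddIdx]

theorem bits_evenIdx_succ (i : Fin (2 ^ n)) (k : Fin n) :
    bits (evenIdx i) k.succ = bits i k := by
  ext
  simp only [bits_val, evenIdx, Fin.val_succ, pow_succ', ← Nat.div_div_eq_div_mul]
  congr 2
  omega

theorem bits_oddIdx_succ (i : Fin (2 ^ n)) (k : Fin n) :
    bits (oddIdx i) k.succ = bits i k := by
  ext
  simp only [bits_val, oddIdx, Fin.val_succ, pow_succ', ← Nat.div_div_eq_div_mul]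
  congr 2
  omega

theorem bits_lowIdx_last (j : Fin (2 ^ n)) : bits (lowIdx j) (Fin.last n) = 0 := by
  ext; simp [bits_val, lowIdx, Nat.div_eq_of_lt j.2]

theorem bits_highIdx_last (j : Fin (2 ^ n)) : bits (highIdx j) (Fin.last n) = 1 := by
  ext; simp [bits_val, highIdx, Nat.add_div_left, Nat.div_eq_of_lt j.2]

theorem bits_lowIdx_castSucc (j : Fin (2 ^ n)) (k : Fin n) :
    bits (lowIdx j) k.castSucc = bits j k := by
  ext; simp [bits_val, lowIdx]

theorem bits_highIdx_castSucc (j : Fin (2 ^ n)) (k : Fin n) :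
    bits (highIdx j) k.castSucc = bits j k := by
  ext
  simp only [bits_val, highIdx, Fin.val_castSucc]
  have h : 2 ^ n = 2 ^ (k : ℕ) * (2 * 2 ^ (n - k - 1)) := by
    rw [← pow_succ', ← pow_add]
    congr 1
    have := k.2
    omega
  have h' : 2 ^ n + (j : ℕ) = 2 ^ (k : ℕ) * (2 * 2 ^ (n - k - 1)) + j := by omega
  rw [h', Nat.mul_add_div (by positivity), Nat.mul_add_mod]

/-- Because of the bit reversal, the lowest digit of the input index meets the highest digit of the
output index. Hence inputs split by parity while channels split into halves. -/
theorem polarMatrix_succ (i : Fin (2 ^ (n + 1))) (j : Fin (2 ^ (n + 1))) {i' j' : Fin (2 ^ n)}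
    (hi : ∀ k : Fin n, bits i k.succ = bits i' k)
    (hj : ∀ k : Fin n, bits j k.castSucc = bits j' k) :
    polarMatrix (n + 1) i j = polarMatrix n i' j' * kernelF (bits i 0) (bits j (Fin.last n)) := by
  rw [polarMatrix_apply, polarMatrix_apply, Fin.prod_univ_castSucc]
  simp [Fin.rev_castSucc, hi, hj]

theorem vecMul_lowIdx (u : Fin (2 ^ (n + 1)) → ZMod 2) (j : Fin (2 ^ n)) :
    (u ᵥ* polarMatrix (n + 1)) (lowIdx j) =
      ((fun i => u (evenIdx i) + u (oddIdx i)) ᵥ* polarMatrix n) j := by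
  simp only [Matrix.vecMul, dotProduct, sum_parity]
  refine Finset.sum_congr rfl fun i _ => ?_
  rw [polarMatrix_succ _ _ (bits_evenIdx_succ i) (bits_lowIdx_castSucc j),
    polarMatrix_succ _ _ (bits_oddIdx_succ i) (bits_lowIdx_castSucc j),
    bits_evenIdx_zero, bits_oddIdx_zero, bits_lowIdx_last]
  simp [kernelF, add_mul]

theorem vecMul_highIdx (u : Fin (2 ^ (n + 1)) → ZMod 2) (j : Fin (2 ^ n)) :
    (u ᵥ* polarMatrix (n + 1)) (highIdx j) = ((fun i => u (oddIdx i)) ᵥ* polarMatrix n) j := by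
  simp only [Matrix.vecMul, dotProduct, sum_parity]
  refine Finset.sum_congr rfl fun i _ => ?_
  rw [polarMatrix_succ _ _ (bits_evenIdx_succ i) (bits_highIdx_castSucc j),
    polarMatrix_succ _ _ (bits_oddIdx_succ i) (bits_highIdx_castSucc j),
    bits_evenIdx_zero, bits_oddIdx_zero, bits_highIdx_last]
  simp [kernelF]

/-- The change of variables `u ↦ (s, t)` with `s i = u (2 i) + u (2 i + 1)`,
`t i = u (2 i + 1)`. -/
noncomputable def inputEquiv (n : ℕ) : (Fin (2 ^ (n + 1)) → ZMod 2) ≃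
    (Fin (2 ^ n) → ZMod 2) × (Fin (2 ^ n) → ZMod 2) :=
  Equiv.ofBijective
    (fun u => (fun i => u (evenIdx i) + u (oddIdx i), fun i => u (oddIdx i))) <| by
    constructor
    · intro u v h
      simp only [Prod.mk.injEq, funext_iff] at h
      funext k
      obtain ⟨i, rfl | rfl⟩ := exists_parity k
      · have := h.1 i
        rw [h.2 i] at this
        exact add_right_cancel this
      · exact h.2 i
    · rintro ⟨s, t⟩
      refine ⟨fun k => Sum.elim (fun i => s i - t i) t ((parityEquiv n).symm k), ?_⟩
      have h1 : ∀ i, (parityEquiv n).symm (evenIdx i) = Sum.inl i := fun i =>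
        (Equiv.symm_apply_eq _).2 rfl
      have h2 : ∀ i, (parityEquiv n).symm (oddIdx i) = Sum.inr i := fun i =>
        (Equiv.symm_apply_eq _).2 rfl
      simp [h1, h2]

end Index

/-! ### Outputs of a split channel as pairs of outputs of the two halves -/

section Output

variable {n : ℕ} {Y : Fin (2 ^ (n + 1)) → Type*}

theorem evenIdx_lt_evenIdx {i j : Fin (2 ^ n)} (h : j < i) : evenIdx j < evenIdx i := by
  simp only [evenIdx, Fin.lt_def] at *; omega

theorem oddIdx_lt_evenIdx {i j : Fin (2 ^ n)} (h : j < i) : oddIdx j < evenIdx i := by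
  simp only [evenIdx, oddIdx, Fin.lt_def] at *; omega

theorem evenIdx_lt_oddIdx (i : Fin (2 ^ n)) : evenIdx i < oddIdx i := by
  simp only [evenIdx, oddIdx, Fin.lt_def]; omega

theorem lt_evenIdx_cases {i : Fin (2 ^ n)} {k : Fin (2 ^ (n + 1))} (h : k < evenIdx i) :
    ∃ j, j < i ∧ (k = evenIdx j ∨ k = oddIdx j) := by
  obtain ⟨j, hj⟩ := exists_parity k
  refine ⟨j, ?_, hj⟩
  rcases hj with rfl | rfl <;> simp only [evenIdx, oddIdx, Fin.lt_def] at * <;> omega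

theorem lt_oddIdx_cases {i : Fin (2 ^ n)} {k : Fin (2 ^ (n + 1))} (h : k < oddIdx i) :
    k < evenIdx i ∨ k = evenIdx i := by
  simp only [evenIdx, oddIdx, Fin.lt_def, Fin.ext_iff] at *; omega

/-- The part of the output of a synthesized channel seen by the lower half. -/
def lowOut {i : Fin (2 ^ n)} {k : Fin (2 ^ (n + 1))} (hk : evenIdx i ≤ k)
    (o : ((j : Fin (2 ^ (n + 1))) → Y j) × ({j // j < k} → ZMod 2)) :
    ((j : Fin (2 ^ n)) → Y (lowIdx j)) × ({j // j < i} → ZMod 2) :=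
  (fun j => o.1 (lowIdx j), fun j => o.2 ⟨evenIdx j, (evenIdx_lt_evenIdx j.2).trans_le hk⟩ +
    o.2 ⟨oddIdx j, (oddIdx_lt_evenIdx j.2).trans_le hk⟩)

/-- The part of the output of a synthesized channel seen by the upper half. -/
def highOut {i : Fin (2 ^ n)} {k : Fin (2 ^ (n + 1))} (hk : evenIdx i ≤ k)
    (o : ((j : Fin (2 ^ (n + 1))) → Y j) × ({j // j < k} → ZMod 2)) :
    ((j : Fin (2 ^ n)) → Y (highIdx j)) × ({j // j < i} → ZMod 2) :=
  (fun j => o.1 (highIdx j), fun j => o.2 ⟨oddIdx j, (oddIdx_lt_evenIdx j.2).trans_le hk⟩)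

/-- Together with `output_ext` this makes the outputs at k = 2i correspond to pairs of outputs of
the halves, and those at k = 2i+1 to such pairs with the extra bit u_{2i}. The bit w matters only in
the odd case. -/
theorem exists_output {i : Fin (2 ^ n)} {k : Fin (2 ^ (n + 1))} (hk : evenIdx i ≤ k)
    (w : ZMod 2)
    (p : ((j : Fin (2 ^ n)) → Y (lowIdx j)) × ({j // j < i} → ZMod 2))
    (q : ((j : Fin (2 ^ n)) → Y (highIdx j)) × ({j // j < i} → ZMod 2)) :
    ∃ o : ((j : Fin (2 ^ (n + 1))) → Y j) × ({j // j < k} → ZMod 2),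
      lowOut hk o = p ∧ highOut hk o = q ∧ ∀ h : evenIdx i < k, o.2 ⟨evenIdx i, h⟩ = w := by
  -- At position i the sum is w and the odd input is 0, which forces the even input to be w. Later
  -- positions are irrelevant padding.
  obtain ⟨u, hu⟩ := (inputEquiv n).surjective
    (fun j => if h : j < i then p.2 ⟨j, h⟩ else w, fun j => if h : j < i then q.2 ⟨j, h⟩ else 0)
  have h1 : ∀ j, u (evenIdx j) + u (oddIdx j) = if h : j < i then p.2 ⟨j, h⟩ else w :=
    fun j => congrFun (congrArg Prod.fst hu) j
  have h2 : ∀ j, u (oddIdx j) = if h : j < i then q.2 ⟨j, h⟩ else 0 :=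
    fun j => congrFun (congrArg Prod.snd hu) j
  let y : (j : Fin (2 ^ (n + 1))) → Y j := Equiv.piCongrLeft Y (halfEquiv n)
    (fun s => Sum.rec (motive := fun s => Y (halfEquiv n s)) (fun j => p.1 j) (fun j => q.1 j) s)
  refine ⟨(y, fun j => u j), ?_, ?_, ?_⟩
  · refine Prod.ext (funext fun j => ?_) (funext fun j => ?_)
    · exact Equiv.piCongrLeft_apply_apply Y (halfEquiv n) _ (Sum.inl j)
    · simp [lowOut, h1, j.2]
  · refine Prod.ext (funext fun j => ?_) (funext fun j => ?_)
    · exact Equiv.piCongrLeft_apply_apply Y (halfEquiv n) _ (Sum.inr j)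
    · simp [highOut, h2, j.2]
  · intro _
    have := h1 i
    rw [h2 i] at this
    simpa using this

theorem output_ext {i : Fin (2 ^ n)} {k : Fin (2 ^ (n + 1))} (hk : evenIdx i ≤ k)
    (hk' : k ≤ oddIdx i) {o o' : ((j : Fin (2 ^ (n + 1))) → Y j) × ({j // j < k} → ZMod 2)}
    (hl : lowOut hk o = lowOut hk o') (hh : highOut hk o = highOut hk o')
    (hw : ∀ h : evenIdx i < k, o.2 ⟨evenIdx i, h⟩ = o'.2 ⟨evenIdx i, h⟩) : o = o' := by
  refine Prod.ext (funext fun j => ?_) (funext fun ⟨j, hj⟩ => ?_)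
  · obtain ⟨j, rfl | rfl⟩ := exists_half j
    · exact congrFun (congrArg Prod.fst hl) j
    · exact congrFun (congrArg Prod.fst hh) j
  · rcases lt_oddIdx_cases (hj.trans_le hk') with h | rfl
    · obtain ⟨j, hji, rfl | rfl⟩ := lt_evenIdx_cases h
      · have e1 := congrFun (congrArg Prod.snd hl) ⟨j, hji⟩
        have e2 := congrFun (congrArg Prod.snd hh) ⟨j, hji⟩
        simp only [lowOut, highOut] at e1 e2
        rw [e2] at e1
        exact add_right_cancel e1
      · exact congrFun (congrArg Prod.snd hh) ⟨j, hji⟩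
    · exact hw hj

end Output

/-! ### One level of the polar recursion for synthesized channels -/

section Recursion

variable {n : ℕ} {Y : Fin (2 ^ (n + 1)) → Type*} [∀ i, Fintype (Y i)]

/-- The lower half of a family of channels. -/
def lowHalf (W : (i : Fin (2 ^ (n + 1))) → BDMC (Y i)) (i : Fin (2 ^ n)) : BDMC (Y (lowIdx i)) :=
  W (lowIdx i)

/-- The upper half of a family of channels. -/
def highHalf (W : (i : Fin (2 ^ (n + 1))) → BDMC (Y i)) (i : Fin (2 ^ n)) :
    BDMC (Y (highIdx i)) :=
  W (highIdx i)

theorem combined_succ (W : (i : Fin (2 ^ (n + 1))) → BDMC (Y i)) (u : Fin (2 ^ (n + 1)) → ZMod 2)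
    (y : (i : Fin (2 ^ (n + 1))) → Y i) :
    combined W u y = combined (lowHalf W) (inputEquiv n u).1 (fun i => y (lowIdx i)) *
      combined (highHalf W) (inputEquiv n u).2 (fun i => y (highIdx i)) := by
  unfold combined
  rw [prod_half]
  simp only [vecMul_lowIdx, vecMul_highIdx]
  rfl

theorem half_mul_splitProb (W : (i : Fin (2 ^ (n + 1))) → BDMC (Y i)) (i : Fin (2 ^ n))
    (a b : ZMod 2) (y : (i : Fin (2 ^ (n + 1))) → Y i) (p q : {j : Fin (2 ^ n) // j < i} → ZMod 2) :
    1 / 2 * (splitProb (lowHalf W) i a (fun i => y (lowIdx i), p) *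
      splitProb (highHalf W) i b (fun i => y (highIdx i), q)) =
    ∑ u : Fin (2 ^ (n + 1)) → ZMod 2 with
      ((inputEquiv n u).1 i = a ∧ (fun j : {j // j < i} => (inputEquiv n u).1 j) = p) ∧
      ((inputEquiv n u).2 i = b ∧ (fun j : {j // j < i} => (inputEquiv n u).2 j) = q),
      1 / 2 ^ (2 ^ (n + 1) - 1) * combined W u y := by
  unfold splitProb
  rw [Finset.sum_mul_sum, ← Finset.sum_product', Finset.mul_sum]
  symm
  refine Finset.sum_equiv (inputEquiv n) (fun u => by simp) fun u _ => ?_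
  rw [combined_succ]
  -- The normalizations differ by one factor 2, since 2N - 1 = 1 + 2(N - 1); this is the 1/2 on the
  -- left.
  have h : (2 : ℝ) ^ (2 ^ (n + 1) - 1) = 2 * (2 ^ (2 ^ n - 1) * 2 ^ (2 ^ n - 1)) := by
    have : 0 < 2 ^ n := by positivity
    rw [← pow_add, ← pow_succ']
    congr 1
    omega
  rw [h]
  field_simp

theorem restrict_eq_iff {i : Fin (2 ^ n)} (u : Fin (2 ^ (n + 1)) → ZMod 2)
    (v : {j // j < evenIdx i} → ZMod 2) :
    (fun j : {j // j < evenIdx i} => u j) = v ↔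
      ((fun j : {j // j < i} => u (evenIdx j) + u (oddIdx j)) =
        fun j : {j // j < i} => v ⟨evenIdx j, evenIdx_lt_evenIdx j.2⟩ +
          v ⟨oddIdx j, oddIdx_lt_evenIdx j.2⟩) ∧
      ((fun j : {j // j < i} => u (oddIdx j)) =
        fun j : {j // j < i} => v ⟨oddIdx j, oddIdx_lt_evenIdx j.2⟩) := by
  constructor
  · rintro rfl
    exact ⟨rfl, rfl⟩
  · rintro ⟨h1, h2⟩
    funext ⟨k, hk⟩
    obtain ⟨j, hj, rfl | rfl⟩ := lt_evenIdx_cases hk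
    · have e1 := congrFun h1 ⟨j, hj⟩
      have e2 := congrFun h2 ⟨j, hj⟩
      simp only at e1 e2
      rw [e2] at e1
      exact add_right_cancel e1
    · exact congrFun h2 ⟨j, hj⟩

theorem splitProb_oddIdx (W : (i : Fin (2 ^ (n + 1))) → BDMC (Y i)) (i : Fin (2 ^ n)) (x : ZMod 2)
    (o : ((j : Fin (2 ^ (n + 1))) → Y j) × ({j // j < oddIdx i} → ZMod 2)) :
    splitProb W (oddIdx i) x o =
      1 / 2 * (splitProb (lowHalf W) i (o.2 ⟨evenIdx i, evenIdx_lt_oddIdx i⟩ + x)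
          (lowOut (evenIdx_lt_oddIdx i).le o) *
        splitProb (highHalf W) i x (highOut (evenIdx_lt_oddIdx i).le o)) := by
  unfold lowOut highOut
  rw [half_mul_splitProb]
  unfold splitProb
  refine Finset.sum_congr (Finset.filter_congr fun u _ => ?_) fun _ _ => rfl
  have hr : (fun j : {j // j < oddIdx i} => u j) = o.2 ↔
      u (evenIdx i) = o.2 ⟨evenIdx i, evenIdx_lt_oddIdx i⟩ ∧
        (fun j : {j // j < evenIdx i} => u j) =
          fun j : {j // j < evenIdx i} => o.2 ⟨j, j.2.trans (evenIdx_lt_oddIdx i)⟩ := by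
    constructor
    · intro h
      rw [← h]
      exact ⟨rfl, rfl⟩
    · rintro ⟨h1, h2⟩
      funext ⟨k, hk⟩
      rcases lt_oddIdx_cases hk with h | rfl
      · exact congrFun h2 ⟨k, h⟩
      · exact h1
  rw [hr, restrict_eq_iff]
  change _ ↔ (u (evenIdx i) + u (oddIdx i) = _ ∧ (fun j : {j // j < i} =>
    u (evenIdx j) + u (oddIdx j)) = _) ∧ (u (oddIdx i) = _ ∧ (fun j : {j // j < i} =>
    u (oddIdx j)) = _)
  constructor
  · rintro ⟨rfl, h1, h2, h3⟩
    exact ⟨⟨by rw [h1], h2⟩, rfl, h3⟩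
  · rintro ⟨⟨h1, h2⟩, rfl, h3⟩
    exact ⟨rfl, add_right_cancel h1, h2, h3⟩

theorem splitProb_evenIdx (W : (i : Fin (2 ^ (n + 1))) → BDMC (Y i)) (i : Fin (2 ^ n)) (x : ZMod 2)
    (o : ((j : Fin (2 ^ (n + 1))) → Y j) × ({j // j < evenIdx i} → ZMod 2)) :
    splitProb W (evenIdx i) x o =
      ∑ w, 1 / 2 * (splitProb (lowHalf W) i (x + w) (lowOut le_rfl o) *
        splitProb (highHalf W) i w (highOut le_rfl o)) := by
  unfold lowOut highOut
  simp only [half_mul_splitProb]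
  unfold splitProb
  -- At an even index the following input u_{2i+1} is still unknown; w runs over its values.
  rw [← Finset.sum_fiberwise _ (fun u => u (oddIdx i))]
  refine Finset.sum_congr rfl fun w _ => ?_
  rw [Finset.filter_filter]
  refine Finset.sum_congr (Finset.filter_congr fun u _ => ?_) fun _ _ => rfl
  rw [restrict_eq_iff]
  change _ ↔ (u (evenIdx i) + u (oddIdx i) = _ ∧ (fun j : {j // j < i} =>
    u (evenIdx j) + u (oddIdx j)) = _) ∧ (u (oddIdx i) = _ ∧ (fun j : {j // j < i} =>
    u (oddIdx j)) = _)
  constructor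
  · rintro ⟨⟨rfl, h2, h3⟩, rfl⟩
    exact ⟨⟨rfl, h2⟩, rfl, h3⟩
  · rintro ⟨⟨h1, h2⟩, rfl, h3⟩
    exact ⟨⟨add_right_cancel h1, h2, h3⟩, rfl⟩

theorem symmCapacity_synthesized_evenIdx (W : (i : Fin (2 ^ (n + 1))) → BDMC (Y i))
    (i : Fin (2 ^ n)) :
    (synthesized W (evenIdx i)).symmCapacity =
      minusInfo (synthesized (lowHalf W) i) (synthesized (highHalf W) i) := by
  rw [symmCapacity_eq_sum_letterInfo, minusInfo, ← Fintype.sum_prod_type']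
  refine Fintype.sum_bijective (fun o => (lowOut le_rfl o, highOut le_rfl o)) ⟨?_, ?_⟩ _ _ ?_
  · intro o o' h
    rw [Prod.mk.injEq] at h
    exact output_ext le_rfl (evenIdx_lt_oddIdx i).le h.1 h.2 fun h => absurd h (lt_irrefl _)
  · rintro ⟨p, q⟩
    obtain ⟨o, h1, h2, -⟩ := exists_output le_rfl 0 p q
    exact ⟨o, Prod.ext h1 h2⟩
  · intro o
    simp only [synthesized, splitProb_evenIdx, sum_zmod_two, ← mul_add]
    rw [show (1 + 1 : ZMod 2) = 0 from rfl, zero_add, zero_add, add_zero]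

theorem symmCapacity_synthesized_oddIdx (W : (i : Fin (2 ^ (n + 1))) → BDMC (Y i))
    (i : Fin (2 ^ n)) :
    (synthesized W (oddIdx i)).symmCapacity =
      plusInfo (synthesized (lowHalf W) i) (synthesized (highHalf W) i) := by
  have key : (synthesized W (oddIdx i)).symmCapacity = ∑ r : (_ × _) × ZMod 2, letterInfo
      (1 / 2 * ((synthesized (lowHalf W) i).prob r.2 r.1.1 *
        (synthesized (highHalf W) i).prob 0 r.1.2))
      (1 / 2 * ((synthesized (lowHalf W) i).prob (r.2 + 1) r.1.1 *
        (synthesized (highHalf W) i).prob 1 r.1.2)) := by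
    have hlt := evenIdx_lt_oddIdx i
    rw [symmCapacity_eq_sum_letterInfo]
    refine Fintype.sum_bijective (fun o => ((lowOut hlt.le o, highOut hlt.le o),
      o.2 ⟨evenIdx i, hlt⟩)) ⟨?_, ?_⟩ _ _ ?_
    · intro o o' h
      simp only [Prod.mk.injEq] at h
      exact output_ext hlt.le le_rfl h.1.1 h.1.2 fun _ => h.2
    · rintro ⟨⟨p, q⟩, w⟩
      obtain ⟨o, h1, h2, h3⟩ := exists_output hlt.le w p q
      exact ⟨o, Prod.ext (Prod.ext h1 h2) (h3 hlt)⟩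
    · intro o
      simp only [synthesized, splitProb_oddIdx, add_zero]
  rw [key, Fintype.sum_prod_type, Fintype.sum_prod_type, plusInfo]
  refine Finset.sum_congr rfl fun p _ => Finset.sum_congr rfl fun q _ => ?_
  simp only [sum_zmod_two]
  rw [show (1 + 1 : ZMod 2) = 0 from rfl, zero_add]

end Recursion

/-! ### Pair steps and the loss of spread -/

/-- The constraints relating the capacities `a`, `b` of two channels to the capacities `a'`, `b'`
of their check-node and variable-node combinations. -/
structure PairStep (a b a' b' : ℝ) : Prop where
  mem_left : a ∈ Set.Icc (0 : ℝ) 1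
  mem_right : b ∈ Set.Icc (0 : ℝ) 1
  mem_minus : a' ∈ Set.Icc (0 : ℝ) 1
  mem_plus : b' ∈ Set.Icc (0 : ℝ) 1
  sum_eq : a' + b' = a + b
  le_left : a' ≤ a * (1 - gapConst * (1 - b) ^ 2)
  le_right : a' ≤ b * (1 - gapConst * (1 - a) ^ 2)

/-- The function `x (1 - x)`, which measures the distance from the polarized values `0`, `1`. -/
def spread (x : ℝ) : ℝ := x * (1 - x)

theorem spread_nonneg {x : ℝ} (hx : x ∈ Set.Icc (0 : ℝ) 1) : 0 ≤ spread x :=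
  mul_nonneg hx.1 (sub_nonneg.2 hx.2)

theorem spread_le_one {x : ℝ} (hx : x ∈ Set.Icc (0 : ℝ) 1) : spread x ≤ 1 := by
  unfold spread; nlinarith [hx.1, hx.2]

namespace PairStep

variable {a b a' b' : ℝ}

theorem symm (h : PairStep a b a' b') : PairStep b a a' b' :=
  ⟨h.mem_right, h.mem_left, h.mem_minus, h.mem_plus, by linarith [h.sum_eq], h.le_right, h.le_left⟩

theorem minus_le_left (h : PairStep a b a' b') : a' ≤ a := by
  have := mul_nonneg h.mem_left.1 (mul_nonneg gapConst_pos.le (sq_nonneg (1 - b)))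
  nlinarith [h.le_left]

theorem minus_le_min (h : PairStep a b a' b') : a' ≤ min a b :=
  le_min h.minus_le_left h.symm.minus_le_left

/-- For a ≤ b and x = a - a', conservation of the sum gives b' = b + x, and the loss is exactly 2x²
+ 2x(b - a). -/
theorem sq_le (h : PairStep a b a' b') :
    2 * (min a b - a') ^ 2 ≤ spread a + spread b - (spread a' + spread b') := by
  wlog hab : a ≤ b generalizing a b with H
  · have := H h.symm (le_of_not_ge hab)
    rw [min_comm]; linarith
  · rw [min_eq_left hab]
    have h1 := h.minus_le_left
    have h2 : b' = a + b - a' := by linarith [h.sum_eq]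
    subst h2
    unfold spread
    nlinarith [mul_nonneg (sub_nonneg.2 h1) (sub_nonneg.2 hab)]

theorem gap_le {η : ℝ} (h : PairStep a b a' b') (hη : 0 ≤ η) (ha : a ∈ Set.Icc η (1 - η))
    (hb : b ∈ Set.Icc η (1 - η)) : gapConst * η ^ 3 ≤ min a b - a' := by
  wlog hab : a ≤ b generalizing a b with H
  · have := H h.symm hb ha (le_of_not_ge hab)
    rwa [min_comm]
  · rw [min_eq_left hab]
    have h1 : η ^ 2 ≤ (1 - b) ^ 2 := pow_le_pow_left₀ hη (by linarith [hb.2]) 2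
    have h2 : η * η ^ 2 ≤ a * (1 - b) ^ 2 := mul_le_mul ha.1 h1 (by positivity) (hη.trans ha.1)
    have h3 := mul_le_mul_of_nonneg_left h2 gapConst_pos.le
    nlinarith [h.le_left]

end PairStep

/-! ### Windows of several levels and comparator networks -/

/-- `Window L S z`: the values `z` arise from `2 ^ L` initial values by `L` levels of pairwise
combination, and `S` is the sum of `spread` over the initial values. -/
def Window : (L : ℕ) → ℝ → ((Fin L → Bool) → ℝ) → Prop
  | 0, S, z => S = spread (z default) ∧ z default ∈ Set.Icc (0 : ℝ) 1
  | L + 1, S, z => ∃ (S₁ S₂ : ℝ) (z₁ z₂ : (Fin L → Bool) → ℝ), Window L S₁ z₁ ∧ Window L S₂ z₂ ∧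
      S = S₁ + S₂ ∧ ∀ p, PairStep (z₁ p) (z₂ p) (z (Fin.cons false p)) (z (Fin.cons true p))

theorem forall_cons {L : ℕ} {P : (Fin (L + 1) → Bool) → Prop}
    (h : ∀ p : Fin L → Bool, P (Fin.cons false p) ∧ P (Fin.cons true p)) (q) : P q := by
  rw [← Fin.cons_self_tail q]
  cases q 0
  · exact (h _).1
  · exact (h _).2

theorem sum_cons {L : ℕ} (f : (Fin (L + 1) → Bool) → ℝ) :
    ∑ q, f q = ∑ p : Fin L → Bool, (f (Fin.cons false p) + f (Fin.cons true p)) := by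
  rw [← (Fin.consEquiv fun _ => Bool).sum_comp f, Fintype.sum_prod_type_right]
  refine Finset.sum_congr rfl fun p _ => ?_
  rw [Fintype.sum_bool, add_comm]
  rfl

theorem Window.mem_Icc : ∀ {L : ℕ} {S : ℝ} {z : (Fin L → Bool) → ℝ}, Window L S z →
    ∀ p, z p ∈ Set.Icc (0 : ℝ) 1
  | 0, _, _, h, p => by rw [Subsingleton.elim p default]; exact h.2
  | _ + 1, _, z, ⟨_, _, _, _, _, _, _, h⟩, p =>
    forall_cons (P := fun q => z q ∈ Set.Icc (0 : ℝ) 1) (fun p => ⟨(h p).mem_minus, (h p).mem_plus⟩) p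

theorem Window.sum_spread_le : ∀ {L : ℕ} {S : ℝ} {z : (Fin L → Bool) → ℝ}, Window L S z →
    ∑ p, spread (z p) ≤ S
  | 0, _, z, h => by
    rw [h.1, Fintype.sum_unique]
    exact (congrArg (fun p => spread (z p)) (Subsingleton.elim _ _)).le
  | L + 1, S, z, ⟨S₁, S₂, z₁, z₂, h₁, h₂, hS, h⟩ => by
    rw [sum_cons, hS]
    calc _ ≤ ∑ p, (spread (z₁ p) + spread (z₂ p)) := Finset.sum_le_sum fun p _ => by
          linarith [(h p).sq_le, sq_nonneg (min (z₁ p) (z₂ p) - z (Fin.cons false p))]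
      _ ≤ _ := by
          rw [Finset.sum_add_distrib]
          exact add_le_add h₁.sum_spread_le h₂.sum_spread_le

/-- If little `spread` is lost within a window, then its outputs are close to those of a network
of comparators, and the nonpolarized outputs of that network form an antichain. -/
theorem Window.exists_comparator {δ ε : ℝ} (hδ : 0 < δ) (hε : 0 < ε)
    (hgap : ε < gapConst * (δ / 2) ^ 3) : ∀ {L : ℕ} {S : ℝ} {z : (Fin L → Bool) → ℝ},
    Window L S z → L * ε ≤ δ / 2 → S - ∑ p, spread (z p) ≤ 2 * ε ^ 2 →
    ∃ w : (Fin L → Bool) → ℝ, Monotone w ∧ (∀ p, w p ∈ Set.Icc (0 : ℝ) 1) ∧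
      (∀ p, |w p - z p| ≤ L * ε) ∧
      ∀ p q, p ≤ q → w p ∈ Set.Icc δ (1 - δ) → w q ∈ Set.Icc δ (1 - δ) → p = q
  | 0, _, z, h, _, _ => ⟨z, fun p q _ => by rw [Subsingleton.elim p q], h.mem_Icc, by simp,
      fun _ _ _ _ _ => Subsingleton.elim _ _⟩
  | L + 1, S, z, ⟨S₁, S₂, z₁, z₂, h₁, h₂, hS, h⟩, hL, hdrop => by
    push_cast at hL
    have hnn : ∀ p, 0 ≤ spread (z₁ p) + spread (z₂ p) -
        (spread (z (Fin.cons false p)) + spread (z (Fin.cons true p))) := fun p =>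
      le_trans (by positivity) (h p).sq_le
    -- The loss splits into the losses inside the two subwindows and those at the last level. All
    -- are nonnegative, so the same budget 2ε² bounds each of them.
    have htot : (S₁ - ∑ p, spread (z₁ p)) + (S₂ - ∑ p, spread (z₂ p)) +
        ∑ p, (spread (z₁ p) + spread (z₂ p) -
          (spread (z (Fin.cons false p)) + spread (z (Fin.cons true p)))) ≤ 2 * ε ^ 2 := by
      rw [sum_cons, hS] at hdrop
      simp only [Finset.sum_sub_distrib, Finset.sum_add_distrib] at hdrop ⊢
      linarith
    have hs₁ := h₁.sum_spread_le
    have hs₂ := h₂.sum_spread_le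
    have hs := Finset.sum_nonneg fun p (_ : p ∈ Finset.univ) => hnn p
    obtain ⟨w₁, m₁, i₁, c₁, a₁⟩ := h₁.exists_comparator hδ hε hgap (by linarith) (by linarith)
    obtain ⟨w₂, m₂, i₂, c₂, a₂⟩ := h₂.exists_comparator hδ hε hgap (by linarith) (by linarith)
    have hd : ∀ p, min (z₁ p) (z₂ p) - z (Fin.cons false p) ≤ ε := fun p => by
      have e := Finset.single_le_sum (fun p _ => hnn p) (Finset.mem_univ p)
      have := (h p).sq_le
      exact le_of_sq_le_sq (by linarith) hε.le
    have hLε : L * ε ≤ δ / 2 := by linarith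
    -- Middling `w₁ p` and `w₂ p` would put `z₁ p` and `z₂ p` in [δ/2, 1 - δ/2], as the accumulated
    -- error is at most δ/2. Their combination would then open a gap larger than ε.
    have hcoll : ∀ p, w₁ p ∈ Set.Icc δ (1 - δ) → w₂ p ∈ Set.Icc δ (1 - δ) → False := by
      intro p k₁ k₂
      have b₁ := abs_le.1 (c₁ p)
      have b₂ := abs_le.1 (c₂ p)
      have := (h p).gap_le (η := δ / 2) (by positivity)
        ⟨by linarith [k₁.1], by linarith [k₁.2]⟩ ⟨by linarith [k₂.1], by linarith [k₂.2]⟩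
      linarith [hd p]
    let w : (Fin (L + 1) → Bool) → ℝ := fun q =>
      if q 0 then max (w₁ (Fin.tail q)) (w₂ (Fin.tail q))
      else min (w₁ (Fin.tail q)) (w₂ (Fin.tail q))
    have wf : ∀ p, w (Fin.cons false p) = min (w₁ p) (w₂ p) := fun p => by simp [w]
    have wt : ∀ p, w (Fin.cons true p) = max (w₁ p) (w₂ p) := fun p => by simp [w]
    refine ⟨w, ?_, ?_, ?_, ?_⟩
    · refine forall_cons (fun p => ⟨forall_cons fun q => ⟨?_, ?_⟩, forall_cons fun q => ⟨?_, ?_⟩⟩)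
        <;> rw [Fin.cons_le_cons] <;> rintro ⟨h0, hpq⟩ <;> simp only [wf, wt]
      · exact min_le_min (m₁ hpq) (m₂ hpq)
      · exact (min_le_min (m₁ hpq) (m₂ hpq)).trans min_le_max
      · exact absurd h0 (by decide)
      · exact max_le_max (m₁ hpq) (m₂ hpq)
    · refine forall_cons fun p => ?_
      rw [wf, wt]
      exact ⟨⟨le_min (i₁ p).1 (i₂ p).1, min_le_of_left_le (i₁ p).2⟩,
        ⟨le_max_of_le_left (i₁ p).1, max_le (i₁ p).2 (i₂ p).2⟩⟩
    · refine forall_cons fun p => ?_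
      rw [wf, wt]
      push_cast
      have hmin := (abs_min_sub_min_le_max (w₁ p) (w₂ p) (z₁ p) (z₂ p)).trans
        (max_le (c₁ p) (c₂ p))
      have hmax := (abs_max_sub_max_le_max (w₁ p) (w₂ p) (z₁ p) (z₂ p)).trans
        (max_le (c₁ p) (c₂ p))
      -- By conservation, the larger output exceeds the maximum by exactly the amount by which the
      -- smaller falls below the minimum, so one level adds at most ε to either error.
      have hsum := (h p).sum_eq
      have hmm := min_add_max (z₁ p) (z₂ p)
      have hle := (h p).minus_le_min
      have := hd p
      rw [abs_le] at hmin hmax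
      exact ⟨abs_le.2 ⟨by linarith, by linarith⟩, abs_le.2 ⟨by linarith, by linarith⟩⟩
    · have key : ∀ {e f : Bool} {p q : Fin L → Bool}, e ≤ f → p ≤ q →
          w (Fin.cons e p) ∈ Set.Icc δ (1 - δ) → w (Fin.cons f q) ∈ Set.Icc δ (1 - δ) →
          e = f ∧ p = q := by
        -- Middling values from different subnetworks at p ≤ q force a collision. If e is false, the
        -- minimum at p is at least δ, so monotonicity makes y middling at p; if e is true, so is f,
        -- and the maximum at q makes x middling there.
        have cross : ∀ {x y : (Fin L → Bool) → ℝ} {e f : Bool} {p q : Fin L → Bool}, Monotone x →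
            Monotone y → (∀ p, x p ∈ Set.Icc δ (1 - δ) → y p ∈ Set.Icc δ (1 - δ) → False) →
            e ≤ f → p ≤ q → (e = false → δ ≤ y p) → (f = true → x q ≤ 1 - δ) →
            x p ∈ Set.Icc δ (1 - δ) → y q ∈ Set.Icc δ (1 - δ) → False := by
          intro x y e f p q mx my hxy hef hpq hp hq hxp hyq
          cases e
          · exact hxy p hxp ⟨hp rfl, (my hpq).trans hyq.2⟩
          · exact hxy q ⟨hxp.1.trans (mx hpq), hq (hef rfl)⟩ hyq
        intro e f p q hef hpq hp hq
        have lo : e = false → δ ≤ w₁ p ∧ δ ≤ w₂ p := by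
          rintro rfl; rw [wf] at hp; exact le_min_iff.1 hp.1
        have hi : f = true → w₁ q ≤ 1 - δ ∧ w₂ q ≤ 1 - δ := by
          rintro rfl; rw [wt] at hq; exact max_le_iff.1 hq.2
        have alt : ∀ {e : Bool} {p : Fin L → Bool}, w (Fin.cons e p) ∈ Set.Icc δ (1 - δ) →
            w₁ p ∈ Set.Icc δ (1 - δ) ∨ w₂ p ∈ Set.Icc δ (1 - δ) := by
          intro e p hp
          cases e
          · rw [wf] at hp
            rcases min_choice (w₁ p) (w₂ p) with h | h <;> rw [h] at hp <;> tauto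
          · rw [wt] at hp
            rcases max_choice (w₁ p) (w₂ p) with h | h <;> rw [h] at hp <;> tauto
        have hpq' : p = q := by
          rcases alt hp with k₁ | k₁ <;> rcases alt hq with k₂ | k₂
          · exact a₁ p q hpq k₁ k₂
          · exact (cross m₁ m₂ hcoll hef hpq (fun h => (lo h).2) (fun h => (hi h).1) k₁ k₂).elim
          · exact (cross m₂ m₁ (fun p a b => hcoll p b a) hef hpq (fun h => (lo h).1)
              (fun h => (hi h).2) k₁ k₂).elim
          · exact a₂ p q hpq k₁ k₂
        subst hpq'
        refine ⟨?_, rfl⟩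
        -- Otherwise both the minimum and the maximum at p are middling, hence so are both inputs.
        by_contra hne
        have he : e = false := by revert hef hne; cases e <;> cases f <;> decide
        have hf : f = true := by revert hef hne; cases e <;> cases f <;> decide
        exact hcoll p ⟨(lo he).1, (hi hf).1⟩ ⟨(lo he).2, (hi hf).2⟩
      intro p q
      rw [← Fin.cons_self_tail p, ← Fin.cons_self_tail q, Fin.cons_le_cons]
      rintro ⟨h0, hpq⟩ hp hq
      obtain ⟨r1, r2⟩ := key h0 hpq hp hq
      rw [r1, r2]

/-! ### Sperner's bound and the dichotomy for windows -/

/-- The factor 2m+1 makes the induction close, through (2m+1)(2m+3) ≤ (2m+2)². It shows that the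
middle binomial coefficient is o(4^m). -/
theorem centralBinom_sq_mul_le (m : ℕ) : m.centralBinom ^ 2 * (2 * m + 1) ≤ 16 ^ m := by
  induction m with
  | zero => simp
  | succ m ih =>
    have h := Nat.succ_mul_centralBinom_succ m
    have hpos : 0 < (m + 1) ^ 2 := by positivity
    refine Nat.le_of_mul_le_mul_left ?_ hpos
    calc (m + 1) ^ 2 * ((m + 1).centralBinom ^ 2 * (2 * (m + 1) + 1))
        = ((m + 1) * (m + 1).centralBinom) ^ 2 * (2 * m + 3) := by ring
      _ = (m.centralBinom ^ 2 * (2 * m + 1)) * (4 * ((2 * m + 1) * (2 * m + 3))) := by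
          rw [h]; ring
      _ ≤ 16 ^ m * (4 * ((2 * m + 1) * (2 * m + 3))) := Nat.mul_le_mul_right _ ih
      _ ≤ 16 ^ m * (16 * (m + 1) ^ 2) := Nat.mul_le_mul_left _ (by nlinarith)
      _ = (m + 1) ^ 2 * 16 ^ (m + 1) := by ring

theorem card_le_choose_of_antichain {L : ℕ} (s : Finset (Fin L → Bool))
    (hs : ∀ p ∈ s, ∀ q ∈ s, p ≤ q → p = q) : s.card ≤ L.choose (L / 2) := by
  classical
  let f : (Fin L → Bool) → Finset (Fin L) := fun p => Finset.univ.filter fun k => p k = true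
  have hf : ∀ p q, f p ⊆ f q → p ≤ q := by
    intro p q h k
    have := @h k
    simp only [f, Finset.mem_filter, Finset.mem_univ, true_and] at this
    exact Bool.le_iff_imp.2 this
  have hinj : Function.Injective f := fun p q h =>
    le_antisymm (hf p q h.le) (hf q p h.ge)
  have hanti : IsAntichain (· ⊆ ·) (s.image f : Set (Finset (Fin L))) := by
    intro x hx y hy hxy hle
    simp only [Finset.coe_image, Set.mem_image, Finset.mem_coe] at hx hy
    obtain ⟨p, hp, rfl⟩ := hx
    obtain ⟨q, hq, rfl⟩ := hy
    exact hxy (congrArg f (hs p hp q hq (hf p q hle)))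
  have := hanti.sperner
  rwa [Finset.card_image_of_injective _ hinj, Fintype.card_fin] at this

theorem spread_le_add_abs {x y : ℝ} (hx : x ∈ Set.Icc (0 : ℝ) 1) (hy : y ∈ Set.Icc (0 : ℝ) 1) :
    spread x ≤ spread y + |y - x| := by
  obtain ⟨x0, x1⟩ := hx
  obtain ⟨y0, y1⟩ := hy
  unfold spread
  rcases abs_cases (y - x) with ⟨h, h'⟩ | ⟨h, h'⟩ <;> rw [h] <;> nlinarith

/-- Either a window is nearly polarized, or it loses a definite amount of `spread`. -/
theorem exists_window_bound (L : ℕ) {δ : ℝ} (hδ : 0 < δ) : ∃ K : ℝ, 0 ≤ K ∧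
    ∀ (S : ℝ) (z : (Fin L → Bool) → ℝ), Window L S z →
      ∑ p, spread (z p) ≤ 2 ^ L * (2 * δ) + L.choose (L / 2) + K * (S - ∑ p, spread (z p)) := by
  classical
  obtain ⟨ε, hε, hgap, hL⟩ : ∃ ε : ℝ, 0 < ε ∧ ε < gapConst * (δ / 2) ^ 3 ∧ L * ε ≤ δ / 2 := by
    have hc := gapConst_pos
    refine ⟨min (gapConst * (δ / 2) ^ 3 / 2) (δ / 2 / (L + 1)), by positivity, ?_, ?_⟩
    · refine (min_le_left _ _).trans_lt (half_lt_self (by positivity))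
    · calc L * min (gapConst * (δ / 2) ^ 3 / 2) (δ / 2 / (L + 1))
          ≤ (L + 1) * (δ / 2 / (L + 1)) := by
            refine mul_le_mul (by linarith) (min_le_right _ _) (by positivity) (by positivity)
        _ = δ / 2 := by field_simp
  -- With this K, a loss above 2ε² already pays for the trivial bound 2^L on the final spread.
  refine ⟨2 ^ L / (2 * ε ^ 2), by positivity, fun S z h => ?_⟩
  have hdrop := sub_nonneg.2 h.sum_spread_le
  by_cases hd : S - ∑ p, spread (z p) ≤ 2 * ε ^ 2
  · obtain ⟨w, -, hw, hwz, hanti⟩ := h.exists_comparator hδ hε hgap hL hd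
    set M := Finset.univ.filter fun p => w p ∈ Set.Icc δ (1 - δ) with hM
    have hcard : (M.card : ℝ) ≤ L.choose (L / 2) := by
      exact_mod_cast card_le_choose_of_antichain M fun p hp q hq hpq =>
        hanti p q hpq (Finset.mem_filter.1 hp).2 (Finset.mem_filter.1 hq).2
    have hpt : ∀ p, spread (z p) ≤ 2 * δ + if w p ∈ Set.Icc δ (1 - δ) then 1 else 0 := by
      intro p
      have h1 := (spread_le_add_abs (h.mem_Icc p) (hw p)).trans
        (add_le_add_right ((hwz p).trans hL) _)
      split_ifs with hp
      · linarith [spread_le_one (hw p)]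
      · have : spread (w p) ≤ δ := by
          obtain ⟨w0, w1⟩ := hw p
          unfold spread
          rw [Set.mem_Icc, not_and_or, not_le, not_le] at hp
          rcases hp with hp | hp <;> nlinarith
        linarith
    have hsum : ∑ p, spread (z p) ≤ 2 ^ L * (2 * δ) + M.card := by
      refine (Finset.sum_le_sum fun p _ => hpt p).trans (le_of_eq ?_)
      rw [Finset.sum_add_distrib, Finset.sum_boole, ← hM]
      simp
    have : 0 ≤ 2 ^ L / (2 * ε ^ 2) * (S - ∑ p, spread (z p)) := by positivity
    linarith
  · have h1 : ∑ p, spread (z p) ≤ 2 ^ L := by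
      refine (Finset.sum_le_sum fun p _ => spread_le_one (h.mem_Icc p)).trans (le_of_eq ?_)
      simp
    have h2 : (2 : ℝ) ^ L ≤ 2 ^ L / (2 * ε ^ 2) * (S - ∑ p, spread (z p)) := by
      rw [div_mul_eq_mul_div, le_div_iff₀ (by positivity)]
      exact mul_le_mul_of_nonneg_left (not_le.1 hd).le (by positivity)
    have : (0 : ℝ) ≤ 2 ^ L * (2 * δ) + L.choose (L / 2) := by positivity
    linarith

/-! ### Synthesized capacities as pair steps -/

theorem synthesized_pairStep {n : ℕ} {Y : Fin (2 ^ (n + 1)) → Type*} [∀ i, Fintype (Y i)]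
    (W : (i : Fin (2 ^ (n + 1))) → BDMC (Y i)) (i : Fin (2 ^ n)) :
    PairStep (synthesized (lowHalf W) i).symmCapacity (synthesized (highHalf W) i).symmCapacity
      (synthesized W (evenIdx i)).symmCapacity (synthesized W (oddIdx i)).symmCapacity where
  mem_left := ⟨symmCapacity_nonneg _, symmCapacity_le_one _⟩
  mem_right := ⟨symmCapacity_nonneg _, symmCapacity_le_one _⟩
  mem_minus := ⟨symmCapacity_nonneg _, symmCapacity_le_one _⟩
  mem_plus := ⟨symmCapacity_nonneg _, symmCapacity_le_one _⟩
  sum_eq := by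
    rw [symmCapacity_synthesized_evenIdx, symmCapacity_synthesized_oddIdx, minusInfo_add_plusInfo]
  le_left := by
    rw [symmCapacity_synthesized_evenIdx]
    exact minusInfo_le_left _ _
  le_right := by
    rw [symmCapacity_synthesized_evenIdx, minusInfo_comm]
    exact minusInfo_le_left _ _

/-- The polar transform of a single channel is the channel itself. -/
theorem symmCapacity_synthesized_zero {Y : Fin (2 ^ 0) → Type*} [∀ i, Fintype (Y i)]
    (W : (i : Fin (2 ^ 0)) → BDMC (Y i)) (i : Fin (2 ^ 0)) :
    (synthesized W i).symmCapacity = (W i).symmCapacity := by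
  have hsub : ∀ j : Fin (2 ^ 0), j = i := fun j => by
    have := j.2; have := i.2; ext; omega
  have : IsEmpty {j : Fin (2 ^ 0) // j < i} := ⟨fun j => by
    have := j.2; rw [hsub j] at this; exact lt_irrefl _ this⟩
  have hmat : polarMatrix 0 i i = 1 := by simp [polarMatrix_apply]
  have hprob : ∀ x o, (synthesized W i).prob x o = (W i).prob x (o.1 i) := by
    intro x o
    have hfil : (Finset.univ.filter fun u : Fin (2 ^ 0) → ZMod 2 =>
        u i = x ∧ (fun j : {j // j < i} => u j) = o.2) = {fun _ => x} := by
      ext u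
      simp only [Finset.mem_filter, Finset.mem_univ, true_and, Finset.mem_singleton]
      constructor
      · rintro ⟨rfl, -⟩
        funext j
        rw [hsub j]
      · rintro rfl
        exact ⟨rfl, Subsingleton.elim _ _⟩
    change splitProb W i x o = _
    unfold splitProb
    rw [hfil, Finset.sum_singleton]
    have : combined W (fun _ => x) o.1 = (W i).prob x (o.1 i) := by
      unfold combined
      rw [Fintype.prod_eq_single i fun j h => absurd (hsub j) h]
      congr 1
      rw [Matrix.vecMul, dotProduct, Fintype.sum_eq_single i fun j h => absurd (hsub j) h, hmat,
        mul_one]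
    rw [this]
    simp
  rw [symmCapacity_eq_sum_letterInfo, symmCapacity_eq_sum_letterInfo]
  refine Fintype.sum_bijective (fun o => o.1 i) ⟨?_, ?_⟩ _ _ fun o => by rw [hprob, hprob]
  · intro o o' h
    refine Prod.ext (funext fun j => ?_) (Subsingleton.elim _ _)
    obtain rfl := hsub j
    exact h
  · intro y
    refine ⟨(fun j => (hsub j).symm ▸ y, fun _ => 0), ?_⟩
    rfl

theorem sum_symmCapacity_synthesized : ∀ {n : ℕ} {Y : Fin (2 ^ n) → Type*} [∀ i, Fintype (Y i)]
    (W : (i : Fin (2 ^ n)) → BDMC (Y i)),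
    ∑ i, (synthesized W i).symmCapacity = ∑ i, (W i).symmCapacity
  | 0, _, _, W => Finset.sum_congr rfl fun i _ => symmCapacity_synthesized_zero W i
  | n + 1, _, _, W => by
    rw [sum_parity, sum_half, Finset.sum_congr rfl fun i _ => (synthesized_pairStep W i).sum_eq,
      Finset.sum_add_distrib, sum_symmCapacity_synthesized, sum_symmCapacity_synthesized]
    rfl

/-- Append the binary digits `p` to the index `i`. -/
def appendIdx {n : ℕ} : (L : ℕ) → Fin (2 ^ n) → (Fin L → Bool) → Fin (2 ^ (n + L))
  | 0, i, _ => i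
  | L + 1, i, p => if p 0 then oddIdx (appendIdx L i (Fin.tail p))
      else evenIdx (appendIdx L i (Fin.tail p))

theorem appendIdx_cons_false {n L : ℕ} (i : Fin (2 ^ n)) (p : Fin L → Bool) :
    appendIdx (L + 1) i (Fin.cons false p) = evenIdx (appendIdx L i p) := by
  simp [appendIdx]

theorem appendIdx_cons_true {n L : ℕ} (i : Fin (2 ^ n)) (p : Fin L → Bool) :
    appendIdx (L + 1) i (Fin.cons true p) = oddIdx (appendIdx L i p) := by
  simp [appendIdx]

theorem sum_appendIdx {n : ℕ} : ∀ {L : ℕ} (f : Fin (2 ^ (n + L)) → ℝ),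
    ∑ k, f k = ∑ i : Fin (2 ^ n), ∑ p, f (appendIdx L i p)
  | 0, f => by
    refine Finset.sum_congr rfl fun i _ => ?_
    rw [Fintype.sum_unique]
    rfl
  | L + 1, f => by
    have := sum_parity (n := n + L) f
    rw [sum_appendIdx (L := L)] at this
    refine this.trans (Finset.sum_congr rfl fun i _ => ?_)
    rw [sum_cons]
    simp only [appendIdx_cons_false, appendIdx_cons_true]

-- Contraction of the average spread

universe u

/-- Every family of `2 ^ n` channels has average `spread` at most `B` after the transform. -/
def SpreadBound (n : ℕ) (B : ℝ) : Prop :=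
  ∀ (Y : Fin (2 ^ n) → Type u) [∀ i, Fintype (Y i)] (W : (i : Fin (2 ^ n)) → BDMC (Y i)),
    ∑ i, spread (synthesized W i).symmCapacity ≤ B * 2 ^ n

/-- The initial values of window i are the capacities of the i-th synthesized channels of the 2^L
sub-blocks of length 2^n. Applying the bound to each sub-block controls the sum of all S i. -/
theorem SpreadBound.exists_window {n : ℕ} {B : ℝ} (hB : SpreadBound.{u} n B) :
    ∀ (L : ℕ) (Y : Fin (2 ^ (n + L)) → Type u) [∀ i, Fintype (Y i)]
      (W : (i : Fin (2 ^ (n + L))) → BDMC (Y i)), ∃ S : Fin (2 ^ n) → ℝ,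
      ∑ i, S i ≤ 2 ^ L * (B * 2 ^ n) ∧
      ∀ i, Window L (S i) fun p => (synthesized W (appendIdx L i p)).symmCapacity
  | 0, Y, _, W => ⟨fun i => spread (synthesized W i).symmCapacity, by simpa using hB Y W,
      fun _ => ⟨rfl, symmCapacity_nonneg _, symmCapacity_le_one _⟩⟩
  | L + 1, Y, _, W => by
    obtain ⟨S₁, b₁, h₁⟩ := hB.exists_window L _ (lowHalf (n := n + L) W)
    obtain ⟨S₂, b₂, h₂⟩ := hB.exists_window L _ (highHalf (n := n + L) W)
    refine ⟨fun i => S₁ i + S₂ i, ?_, fun i => ⟨S₁ i, S₂ i, _, _, h₁ i, h₂ i, rfl, fun p => ?_⟩⟩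
    · rw [Finset.sum_add_distrib, pow_succ]
      linarith
    · exact synthesized_pairStep (n := n + L) W _

/-- The final spread occurs on both sides of the summed window bounds; solving for it produces the
denominator 1 + K. The constant K does not depend on n, which permits iteration. -/
theorem exists_spreadBound_step (L : ℕ) {δ : ℝ} (hδ : 0 < δ) : ∃ K : ℝ, 0 ≤ K ∧
    ∀ (n : ℕ) (B : ℝ), SpreadBound.{u} n B →
      SpreadBound.{u} (n + L) ((2 * δ + L.choose (L / 2) / 2 ^ L + K * B) / (1 + K)) := by
  obtain ⟨K, hK, h⟩ := exists_window_bound L hδ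
  refine ⟨K, hK, fun n B hB Y _ W => ?_⟩
  obtain ⟨S, hS, hw⟩ := hB.exists_window L Y W
  have hsum := Finset.sum_le_sum fun i (_ : i ∈ Finset.univ) => h _ _ (hw i)
  rw [Finset.sum_add_distrib, ← Finset.mul_sum, Finset.sum_sub_distrib, ← sum_appendIdx
    (fun k => spread (synthesized W k).symmCapacity), Finset.sum_const, Finset.card_univ,
    Fintype.card_fin, nsmul_eq_mul] at hsum
  have hKS := mul_le_mul_of_nonneg_left hS hK
  rw [div_mul_eq_mul_div, le_div_iff₀ (by positivity)]
  have e : (2 * δ + L.choose (L / 2) / 2 ^ L + K * B) * 2 ^ (n + L) =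
      ((2 ^ n : ℕ) : ℝ) * (2 ^ L * (2 * δ) + L.choose (L / 2)) + K * (2 ^ L * (B * 2 ^ n)) := by
    push_cast
    rw [pow_add]
    field_simp
  rw [e]
  linarith

theorem spreadBound_one (n : ℕ) : SpreadBound.{u} n 1 := by
  intro Y _ W
  refine (Finset.sum_le_sum fun i _ => spread_le_one
    ⟨symmCapacity_nonneg _, symmCapacity_le_one _⟩).trans (le_of_eq ?_)
  simp

theorem exists_spreadBound {ε : ℝ} (hε : 0 < ε) : ∃ N : ℕ, ∀ n ≥ N, SpreadBound.{u} n ε := by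
  obtain ⟨m, hm⟩ : ∃ m : ℕ, (m.centralBinom : ℝ) / 4 ^ m ≤ ε / 3 := by
    obtain ⟨m, hm⟩ := exists_nat_gt (1 / (ε / 3) ^ 2)
    refine ⟨m, ?_⟩
    have h1 : ((m.centralBinom : ℝ)) ^ 2 * (2 * m + 1) ≤ 16 ^ m := by
      exact_mod_cast centralBinom_sq_mul_le m
    refine le_of_sq_le_sq ?_ (by positivity)
    rw [div_lt_iff₀ (by positivity)] at hm
    rw [div_pow, div_le_iff₀ (by positivity), ← pow_mul, mul_comm m 2, pow_mul]
    norm_num only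
    have h2 : (0 : ℝ) ≤ (m : ℝ) := by positivity
    have h3 : 1 ≤ (2 * (m : ℝ) + 1) * (ε / 3) ^ 2 := by nlinarith [sq_nonneg (ε / 3)]
    calc (m.centralBinom : ℝ) ^ 2
        ≤ (m.centralBinom : ℝ) ^ 2 * ((2 * (m : ℝ) + 1) * (ε / 3) ^ 2) :=
          le_mul_of_one_le_right (by positivity) h3
      _ = (ε / 3) ^ 2 * ((m.centralBinom : ℝ) ^ 2 * (2 * m + 1)) := by ring
      _ ≤ (ε / 3) ^ 2 * 16 ^ m := mul_le_mul_of_nonneg_left h1 (by positivity)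
  obtain ⟨K, hK, hstep⟩ := exists_spreadBound_step.{u} (2 * m) (δ := ε / 6) (by positivity)
  set γ : ℝ := 2 * (ε / 6) + (2 * m).choose (2 * m / 2) / 2 ^ (2 * m) with hγ
  have hγε : γ ≤ 2 * (ε / 3) := by
    rw [Nat.centralBinom] at hm
    rw [hγ, Nat.mul_div_cancel_left m two_pos, pow_mul]
    norm_num only
    linarith
  have hγ0 : 0 ≤ γ := by positivity
  -- The map B ↦ (γ + K B)/(1 + K) fixes γ and shrinks the distance to it by K/(1 + K). The start γ
  -- + 1 dominates the trivial bound 1.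
  have hiter : ∀ t n, SpreadBound.{u} (n + t * (2 * m)) (γ + (K / (1 + K)) ^ t) := by
    intro t n
    induction t with
    | zero =>
      intro Y _ W
      have := spreadBound_one (n + 0 * (2 * m)) Y W
      refine this.trans (mul_le_mul_of_nonneg_right ?_ (by positivity))
      simpa using hγ0
    | succ t ih =>
      have := hstep _ _ ih
      rw [add_assoc, ← Nat.succ_mul] at this
      convert this using 1
      rw [pow_succ]
      field_simp
      ring
  obtain ⟨t, ht⟩ := exists_pow_lt_of_lt_one (show 0 < ε / 3 by positivity)
    (show K / (1 + K) < 1 by rw [div_lt_one (by positivity)]; linarith)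
  refine ⟨t * (2 * m), fun n hn Y _ W => ?_⟩
  obtain ⟨n', rfl⟩ := Nat.exists_eq_add_of_le' hn
  exact (hiter t n' Y W).trans (mul_le_mul_of_nonneg_right (by linarith) (by positivity))

/-! ### From vanishing spread to the limit law -/

/-- A function dominated by `spread` up to an arbitrarily small error has vanishing average. -/
theorem tendsto_average_zero (Y : (n : ℕ) → Fin (2 ^ n) → Type u) [∀ n i, Fintype (Y n i)]
    (W : (n : ℕ) → (i : Fin (2 ^ n)) → BDMC (Y n i)) (r : ℝ → ℝ)
    (hr : ∀ ε > 0, ∃ C, 0 ≤ C ∧ ∀ x ∈ Set.Icc (0 : ℝ) 1, |r x| ≤ ε + C * spread x) :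
    Filter.Tendsto (fun n => (∑ i, r (synthesized (W n) i).symmCapacity) / 2 ^ n)
      Filter.atTop (nhds 0) := by
  rw [Metric.tendsto_atTop]
  intro ε hε
  obtain ⟨C, hC, hb⟩ := hr (ε / 3) (by positivity)
  obtain ⟨N, hN⟩ := exists_spreadBound.{u} (show 0 < ε / 3 / (C + 1) by positivity)
  refine ⟨N, fun n hn => ?_⟩
  have h1 := hN n hn (Y n) (W n)
  rw [Real.dist_eq, sub_zero, abs_div, abs_of_pos (by positivity : (0 : ℝ) < 2 ^ n),
    div_lt_iff₀ (by positivity)]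
  calc |∑ i, r (synthesized (W n) i).symmCapacity|
      ≤ ∑ i, |r (synthesized (W n) i).symmCapacity| := Finset.abs_sum_le_sum_abs _ _
    _ ≤ ∑ i, (ε / 3 + C * spread (synthesized (W n) i).symmCapacity) :=
        Finset.sum_le_sum fun i _ => hb _ ⟨symmCapacity_nonneg _, symmCapacity_le_one _⟩
    _ = ε / 3 * 2 ^ n + C * ∑ i, spread (synthesized (W n) i).symmCapacity := by
        rw [Finset.sum_add_distrib, ← Finset.mul_sum]
        simp [mul_comm]
    _ ≤ ε / 3 * 2 ^ n + C * (ε / 3 / (C + 1) * 2 ^ n) := by gcongr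
    _ ≤ ε / 3 * 2 ^ n + ε / 3 * 2 ^ n := by
        have : C * (ε / 3 / (C + 1)) ≤ ε / 3 := by
          rw [mul_div_assoc', div_le_iff₀ (by positivity)]
          nlinarith
        rw [← mul_assoc]
        gcongr
    _ < ε * 2 ^ n := by
        have : (0 : ℝ) < 2 ^ n := by positivity
        nlinarith

theorem averageCapacity_eq {n : ℕ} {Y : Fin (2 ^ n) → Type*} [∀ i, Fintype (Y i)]
    (W : (i : Fin (2 ^ n)) → BDMC (Y i)) :
    averageCapacity W = (∑ i, (synthesized W i).symmCapacity) / 2 ^ n := by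
  rw [averageCapacity, sum_symmCapacity_synthesized]

theorem fractionIn_eq {n : ℕ} {Y : Fin (2 ^ n) → Type*} [∀ i, Fintype (Y i)]
    (W : (i : Fin (2 ^ n)) → BDMC (Y i)) (S : Set ℝ) [DecidablePred (· ∈ S)] :
    fractionIn W S = (∑ i, if (synthesized W i).symmCapacity ∈ S then (1 : ℝ) else 0) / 2 ^ n := by
  rw [fractionIn, Finset.sum_boole, Set.ncard_eq_toFinset_card', Set.toFinset_ofPred]

/-- A continuous function vanishing at `0` and `1` is dominated by `spread` up to a small error. -/
theorem exists_le_add_spread {r : ℝ → ℝ} (hr : ContinuousOn r (Set.Icc 0 1)) (h0 : r 0 = 0)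
    (h1 : r 1 = 0) {ε : ℝ} (hε : 0 < ε) :
    ∃ C, 0 ≤ C ∧ ∀ x ∈ Set.Icc (0 : ℝ) 1, |r x| ≤ ε + C * spread x := by
  obtain ⟨M, hM⟩ := isCompact_Icc.exists_bound_of_continuousOn hr
  obtain ⟨d₀, hd₀, e₀⟩ := Metric.continuousOn_iff.1 hr 0 (by simp) ε hε
  obtain ⟨d₁, hd₁, e₁⟩ := Metric.continuousOn_iff.1 hr 1 (by simp) ε hε
  have hM0 : 0 ≤ M := (norm_nonneg _).trans (hM 0 (by simp))
  -- Away from both endpoint neighbourhoods `spread` is at least d₀ d₁, so this constant absorbs the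
  -- bound M; near an endpoint, continuity already gives ε.
  refine ⟨M / (d₀ * d₁), by positivity, fun x hx => ?_⟩
  have hs := spread_nonneg hx
  by_cases hx0 : x < d₀
  · have := e₀ x hx (by rw [Real.dist_eq, sub_zero, abs_of_nonneg hx.1]; exact hx0)
    rw [h0, Real.dist_eq, sub_zero] at this
    have : 0 ≤ M / (d₀ * d₁) * spread x := by positivity
    linarith
  by_cases hx1 : 1 - x < d₁
  · have := e₁ x hx (by
      rw [Real.dist_eq, abs_sub_comm, abs_of_nonneg (sub_nonneg.2 hx.2)]; exact hx1)
    rw [h1, Real.dist_eq, sub_zero] at this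
    have : 0 ≤ M / (d₀ * d₁) * spread x := by positivity
    linarith
  · have hprod : d₀ * d₁ ≤ spread x :=
      mul_le_mul (not_lt.1 hx0) (not_lt.1 hx1) hd₁.le hx.1
    have h2 : M ≤ M / (d₀ * d₁) * spread x := by
      rw [div_mul_eq_mul_div, le_div_iff₀ (by positivity)]
      exact mul_le_mul_of_nonneg_left hprod hM0
    have h3 := hM x hx
    rw [Real.norm_eq_abs] at h3
    linarith

end IrregularPolar

open IrregularPolar in
theorem mainTheorem1
    (Y : (n : ℕ) → Fin (2 ^ n) → Type*) [∀ n i, Fintype (Y n i)]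
    (W : (n : ℕ) → (i : Fin (2 ^ n)) → IrregularPolar.BDMC (Y n i)) :
    (∀ δ : ℝ, 0 < δ → δ < 1 →
      Filter.Tendsto
        (fun n => IrregularPolar.fractionIn (W n) (Set.Ioc (1 - δ) 1)
          - IrregularPolar.averageCapacity (W n))
        Filter.atTop (nhds 0) ∧
      Filter.Tendsto
        (fun n => IrregularPolar.fractionIn (W n) (Set.Ico 0 δ)
          - (1 - IrregularPolar.averageCapacity (W n)))
        Filter.atTop (nhds 0)) ∧
    (∀ g : ℝ → ℝ, ContinuousOn g (Set.Icc 0 1) →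
      Filter.Tendsto
        (fun n => (∑ i, g (IrregularPolar.synthesized (W n) i).symmCapacity) / 2 ^ n
          - (IrregularPolar.averageCapacity (W n) * g 1
            + (1 - IrregularPolar.averageCapacity (W n)) * g 0))
        Filter.atTop (nhds 0)) := by
  have hone : ∀ n : ℕ, (∑ _i : Fin (2 ^ n), (1 : ℝ)) / 2 ^ n = 1 := fun n => by simp
  refine ⟨fun δ hδ hδ1 => ⟨?_, ?_⟩, fun g hg => ?_⟩
  -- Inside the set the error 1 - x is at most `spread x / (1 - δ)`, as x > 1 - δ; outside it the
  -- error x is at most `spread x / δ`. The sum of the two constants serves both cases.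
  · refine (tendsto_average_zero Y W (fun x => (if x ∈ Set.Ioc (1 - δ) 1 then 1 else 0) - x)
      fun ε hε => ⟨1 / δ + 1 / (1 - δ), ?_, fun x hx => ?_⟩).congr fun n => ?_
    · have := sub_pos.2 hδ1
      positivity
    · have hδ' := sub_pos.2 hδ1
      have hs := spread_nonneg hx
      have t1 : 0 ≤ 1 / δ * spread x := by positivity
      have t2 : 0 ≤ 1 / (1 - δ) * spread x := by positivity
      rw [add_mul]
      split_ifs with h
      · have : 1 - x ≤ 1 / (1 - δ) * spread x := by
          rw [one_div_mul_eq_div, le_div_iff₀ hδ', spread]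
          nlinarith [h.1, hx.2]
        rw [abs_of_nonneg (sub_nonneg.2 hx.2)]
        linarith
      · have hx' : x ≤ 1 - δ := not_lt.1 fun h' => h ⟨h', hx.2⟩
        have : x ≤ 1 / δ * spread x := by
          rw [one_div_mul_eq_div, le_div_iff₀ hδ, spread]
          nlinarith [hx.1]
        rw [zero_sub, abs_neg, abs_of_nonneg hx.1]
        linarith
    · rw [fractionIn_eq, averageCapacity_eq, Finset.sum_sub_distrib, sub_div]
  · refine (tendsto_average_zero Y W (fun x => (if x ∈ Set.Ico 0 δ then 1 else 0) - (1 - x))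
      fun ε hε => ⟨1 / δ + 1 / (1 - δ), ?_, fun x hx => ?_⟩).congr fun n => ?_
    · have := sub_pos.2 hδ1
      positivity
    · have hδ' := sub_pos.2 hδ1
      have hs := spread_nonneg hx
      have t1 : 0 ≤ 1 / δ * spread x := by positivity
      have t2 : 0 ≤ 1 / (1 - δ) * spread x := by positivity
      rw [add_mul]
      split_ifs with h
      · have : x ≤ 1 / (1 - δ) * spread x := by
          rw [one_div_mul_eq_div, le_div_iff₀ hδ', spread]
          nlinarith [h.2, hx.1]
        rw [sub_sub_cancel, abs_of_nonneg hx.1]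
        linarith
      · have hx' : δ ≤ x := not_lt.1 fun h' => h ⟨hx.1, h'⟩
        have : 1 - x ≤ 1 / δ * spread x := by
          rw [one_div_mul_eq_div, le_div_iff₀ hδ, spread]
          nlinarith [hx.2]
        rw [zero_sub, abs_neg, abs_of_nonneg (sub_nonneg.2 hx.2)]
        linarith
    · rw [fractionIn_eq, averageCapacity_eq, Finset.sum_sub_distrib, Finset.sum_sub_distrib,
        sub_div, sub_div, hone]
  · refine (tendsto_average_zero Y W (fun x => g x - (x * g 1 + (1 - x) * g 0)) fun ε hε =>
      exists_le_add_spread ?_ (by simp) (by simp) hε).congr fun n => ?_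
    · exact hg.sub (Continuous.continuousOn (by fun_prop))
    · rw [averageCapacity_eq, Finset.sum_sub_distrib, Finset.sum_add_distrib, ← Finset.sum_mul,
        ← Finset.sum_mul, Finset.sum_sub_distrib, sub_div, add_div, mul_div_right_comm,
        mul_div_right_comm, sub_div, hone]
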